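/- All graphs are finite, simple and undirected. Let $G$ be a connected graph. Given an edge-coloring $c\colon E(G)\to\{1,\dots,q\}$, in which adjacent edges may receive the same color, and a set $S\subseteq V(G)$, a \emph{rainbow $S$-tree} is a subgraph of $G$ that is a tree, contains every vertex of $S$, and has no two edges of the same color. The \emph{$3$-rainbow index} $rx_3(G)$ is the least number $q$ of colors for which $G$ has an edge-coloring with $q$ colors such that every set $S$ of three vertices of $G$ has a rainbow $S$-tree. The \emph{$3$-sun} is the graph obtained from the cycle $C_6=v_1v_2v_3v_4v_5v_6v_1$ by adding the three edges $v_2v_4$, $v_2v_6$ and $v_4v_6$; $K_5-e$ denotes $K_5$ with one edge deleted. \textbf{Theorem.} Let $G$ be a $2$-connected graph of order $n\ge 4$. Then $rx_3(G)\le n-2$. Moreover, $rx_3(G)=n-2$ if and only if (up to isomorphism) at least one of the following holds: $G=C_n$; $G$ is a spanning subgraph of the $3$-sun; $G$ is a spanning subgraph of $K_5-e$; $G$ is a spanning subgraph of $K_4$. -/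

import Mathlib

namespace SimpleGraph

/-- A graph is 2-connected if it has at least three vertices, is connected, and remains connected
after the deletion of any single vertex. -/
structure IsTwoConnected {V : Type*} [Fintype V] (G : SimpleGraph V) : Prop where
  three_le_card : 3 ≤ Fintype.card V
  connected : G.Connected
  connected_delete : ∀ v : V, (G.induce {v}ᶜ).Connected

/-- The subgraph `T` of `G` is a rainbow `S`-tree for the edge-coloring `c`: it is a tree, it
contains all vertices of `S`, and no two of its edges receive the same color. -/
structure IsRainbowTree {V K : Type*} {G : SimpleGraph V} (c : G.EdgeLabeling K) (S : Finset V)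
    (T : G.Subgraph) : Prop where
  isTree : T.coe.IsTree
  subset_verts : (S : Set V) ⊆ T.verts
  rainbow : ∀ e f : G.edgeSet, (e : Sym2 V) ∈ T.edgeSet → (f : Sym2 V) ∈ T.edgeSet →
    c e = c f → e = f

/-- An edge-coloring is a `k`-rainbow coloring if every `k`-subset `S` of the vertices has a
rainbow `S`-tree. Adjacent edges may receive the same color. -/
def IsRainbowColoring {V K : Type*} {G : SimpleGraph V} (k : ℕ) (c : G.EdgeLabeling K) : Prop :=
  ∀ S : Finset V, S.card = k → ∃ T : G.Subgraph, IsRainbowTree c S T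

/-- The `k`-rainbow index: the minimum number `q` of colors for which a `k`-rainbow coloring
with `q` colors exists (and `⊤` if there is none for any `q`). -/
noncomputable def rainbowIndex {V : Type*} (k : ℕ) (G : SimpleGraph V) : ℕ∞ :=
  ⨅ q ∈ {q : ℕ | ∃ c : G.EdgeLabeling (Fin q), IsRainbowColoring k c}, (q : ℕ∞)

/-- `G` is, up to isomorphism, a spanning subgraph of `H`. -/
def IsSpanningSubgraphOf {V W : Type*} (G : SimpleGraph V) (H : SimpleGraph W) : Prop :=
  ∃ f : V ≃ W, ∀ u v : V, G.Adj u v → H.Adj (f u) (f v)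

/-- The 3-sun: the 6-cycle on `0, 1, 2, 3, 4, 5` together with the edges of a triangle on the
alternate vertices `1, 3, 5`. -/
def threeSun : SimpleGraph (Fin 6) :=
  cycleGraph 6 ⊔ fromEdgeSet {s(1, 3), s(1, 5), s(3, 5)}

/-- The complete graph on five vertices with one edge deleted. -/
def completeFiveMinusEdge : SimpleGraph (Fin 5) :=
  (⊤ : SimpleGraph (Fin 5)).deleteEdges {s(0, 1)}

end SimpleGraph

/-!
Call a graph on `n` vertices `t`-good if `n - t` colors suffice to connect every triple of vertices
by a rainbow tree. Lifting a coloring along the contraction of one edge, with a fresh color for that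
edge, shows that `t`-goodness passes from a contraction to the graph itself
(`RainbowConnectsTriples.of_contract`). Every 2-connected graph on at least four vertices has an
edge whose contraction is 2-connected (`IsTwoConnected.exists_contractInto`), so induction on the
number of vertices reduces statements on goodness to small graphs. Contracting down to the
four-cycle gives the upper bound `n - 2`.

For `3`-goodness, a graph whose contraction is Hamiltonian is itself Hamiltonian or consists, up to
further edges, of a cycle missing one vertex and an ear through that vertex
(`IsTwoConnected.cycle_or_ear_of_contractInto`); over at least five cycle vertices, the latter is
`3`-good. Hence for `n ≥ 6` every 2-connected graph is `3`-good or Hamiltonian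
(`IsTwoConnected.cycleGraph_or_rainbowConnectsTriples`), the only exceptional contraction being
`K_{2,3}` for `n = 6`. A cycle with a chord is `3`-good for `n ≥ 7`, which leaves only `C_n`; for
`n = 6` the chords that do not lead to a `3`-good graph fit into the 3-sun, and for `n = 5` the
complete graph is `3`-good.

Conversely, the exceptional graphs are not `3`-good. In the 3-sun, in `K_5 - e` and on four vertices
this is a short argument about few edges. If `C_n` is colored with `n - 3` colors, the circle can be
cut at three vertices into arcs any two of which together repeat a color
(`exists_arcs_complement_repeats`), while a connected edge set containing these vertices contains
two of the arcs.
-/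

namespace SimpleGraph

variable {V W : Type*}

/-! ### Rainbow connection by edge sets -/

/-- Some edge-coloring of `G` rainbow-connects every triple of vertices with `k` colors. In place of
a tree this asks for a set `F` of edges with distinct colors below `k` in which the three vertices
are mutually reachable; a spanning tree of their component in `F` is then a rainbow tree. The
coloring is total on `Sym2 V` with natural-number values, so that it can be transported along maps
of vertices, and the three vertices need not be distinct. -/
def RainbowConnectsTriples (G : SimpleGraph V) (k : ℕ) : Prop :=
  ∃ c : Sym2 V → ℕ, ∀ x y z : V, ∃ F : Set (Sym2 V), F ⊆ G.edgeSet ∧ (∀ e ∈ F, c e < k) ∧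
    Set.InjOn c F ∧ (fromEdgeSet F).Reachable x y ∧ (fromEdgeSet F).Reachable x z

/-- Reachability lifts along a map `f` if adjacent vertices downstairs have adjacent preimages and
the fibers of `f` are connected upstairs. -/
lemma Reachable.of_map {H : SimpleGraph V} {K : SimpleGraph W} (f : V → W)
    (hfib : ∀ x y, f x = f y → H.Reachable x y)
    (hlift : ∀ p q, K.Adj p q → ∃ x y, f x = p ∧ f y = q ∧ H.Adj x y)
    {x y : V} (h : K.Reachable (f x) (f y)) : H.Reachable x y := by
  obtain ⟨w⟩ := h
  generalize hp : f x = p at w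
  generalize hq : f y = q at w
  induction w generalizing x with
  | nil => exact hfib _ _ (hp.trans hq.symm)
  | cons hadj w ih =>
    obtain ⟨a, b, ha, hb, hab⟩ := hlift _ _ hadj
    exact ((hfib x a (hp.trans ha.symm)).trans hab.reachable).trans (ih hb hq)

/-- Contracting one edge lowers the number of colors needed by at most one: the contracted edge
receives a fresh color, and every other edge inherits the color of its image. -/
lemma RainbowConnectsTriples.of_contract {G : SimpleGraph V} {H : SimpleGraph W} {k : ℕ}
    (f : V → W) {a b : V} (hab : G.Adj a b)
    (hfib : ∀ x y, f x = f y → x = y ∨ s(x, y) = s(a, b))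
    (hlift : ∀ p q, H.Adj p q → ∃ x y, f x = p ∧ f y = q ∧ G.Adj x y)
    (h : H.RainbowConnectsTriples k) : G.RainbowConnectsTriples (k + 1) := by
  classical
  obtain ⟨c, hc⟩ := h
  refine ⟨fun e => if e = s(a, b) then k else c (e.map f), fun x y z => ?_⟩
  obtain ⟨F, hF, hlt, hinj, hy, hz⟩ := hc (f x) (f y) (f z)
  have hl : ∀ e : F, ∃ e' ∈ G.edgeSet, e'.map f = e := by
    rintro ⟨e, he⟩
    induction e using Sym2.ind with
    | _ p q =>
      obtain ⟨x, y, rfl, rfl, hxy⟩ := hlift p q (hF he)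
      exact ⟨s(x, y), hxy, rfl⟩
  choose g hgG hgf using hl
  have key : ∀ {y : V}, (fromEdgeSet F).Reachable (f x) (f y) →
      (fromEdgeSet (Set.range g ∪ {s(a, b)})).Reachable x y := by
    intro y hy
    refine Reachable.of_map f (fun x y hxy => ?_) (fun p q hpq => ?_) hy
    · rcases hfib x y hxy with rfl | h
      · rfl
      · rcases eq_or_ne x y with rfl | hne
        · rfl
        · exact Adj.reachable (by simp [fromEdgeSet_adj, h, hne])
    · rw [fromEdgeSet_adj] at hpq
      have h1 := hgf ⟨_, hpq.1⟩
      have h2 : g ⟨_, hpq.1⟩ ∈ Set.range g := ⟨_, rfl⟩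
      generalize g ⟨_, hpq.1⟩ = e at h1 h2
      induction e using Sym2.ind with
      | _ u v =>
        simp only [Sym2.map_mk, Sym2.eq_iff] at h1
        have huv : u ≠ v := by
          rintro rfl
          rcases h1 with h | h <;> exact hpq.2 (by rw [← h.1, ← h.2])
        rcases h1 with h | h
        · exact ⟨u, v, h.1, h.2, by
            rw [fromEdgeSet_adj]; exact ⟨Or.inl h2, huv⟩⟩
        · exact ⟨v, u, h.2, h.1, by
            rw [fromEdgeSet_adj, Sym2.eq_swap (a := v)]; exact ⟨Or.inl h2, huv.symm⟩⟩
  refine ⟨Set.range g ∪ {s(a, b)}, ?_, ?_, ?_, key hy, key hz⟩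
  · rintro e (⟨e, rfl⟩ | rfl)
    · exact hgG e
    · exact hab
  · rintro e (⟨e, rfl⟩ | rfl)
    · dsimp only
      split_ifs
      · exact k.lt_succ_self
      · rw [hgf]; exact (hlt _ e.2).trans k.lt_succ_self
    · simp
  · have hC : ∀ e : F, g e ≠ s(a, b) →
        (if g e = s(a, b) then k else c ((g e).map f)) = c e ∧ c e < k := fun e he => by
      rw [if_neg he, hgf]; exact ⟨rfl, hlt _ e.2⟩
    rintro e (⟨e, rfl⟩ | rfl) e' (⟨e', rfl⟩ | rfl) hee <;> dsimp only at hee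
    · by_cases h1 : g e = s(a, b) <;> by_cases h2 : g e' = s(a, b)
      · exact h1.trans h2.symm
      · rw [if_pos h1, (hC e' h2).1] at hee; exact absurd (hC e' h2).2 (by omega)
      · rw [if_pos h2, (hC e h1).1] at hee; exact absurd (hC e h1).2 (by omega)
      · rw [(hC e h1).1, (hC e' h2).1] at hee
        rw [Subtype.ext (hinj e.2 e'.2 hee)]
    · by_contra h1
      rw [(hC e h1).1, if_pos rfl] at hee
      exact absurd (hC e h1).2 (by omega)
    · by_contra h1
      rw [(hC e' (Ne.symm h1)).1, if_pos rfl] at hee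
      exact absurd (hC e' (Ne.symm h1)).2 (by omega)
    · rfl

lemma RainbowConnectsTriples.of_isSpanningSubgraphOf {G : SimpleGraph V} {H : SimpleGraph W}
    {k : ℕ} (hHG : H.IsSpanningSubgraphOf G) (h : H.RainbowConnectsTriples k) :
    G.RainbowConnectsTriples k := by
  obtain ⟨g, hg⟩ := hHG
  obtain ⟨c, hc⟩ := h
  have hgg : ∀ e : Sym2 W, (e.map g).map g.symm = e := fun e => by simp [Sym2.map_map]
  refine ⟨fun e => c (e.map g.symm), fun x y z => ?_⟩
  obtain ⟨F, hF, hlt, hinj, hy, hz⟩ := hc (g.symm x) (g.symm y) (g.symm z)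
  have key : ∀ {y : V}, (fromEdgeSet F).Reachable (g.symm x) (g.symm y) →
      (fromEdgeSet (Sym2.map g '' F)).Reachable x y := by
    intro y hy
    refine Reachable.of_map g.symm (fun x y hxy => ?_) (fun p q hpq => ?_) hy
    · rw [g.symm.injective hxy]
    · refine ⟨g p, g q, by simp, by simp, ?_⟩
      rw [fromEdgeSet_adj] at hpq ⊢
      exact ⟨⟨_, hpq.1, rfl⟩, g.injective.ne hpq.2⟩
  refine ⟨Sym2.map g '' F, ?_, ?_, ?_, key hy, key hz⟩
  · rintro _ ⟨e, he, rfl⟩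
    induction e using Sym2.ind with
    | _ p q => exact hg _ _ (hF he)
  · rintro _ ⟨e, he, rfl⟩
    simpa [hgg] using hlt e he
  · rintro _ ⟨e, he, rfl⟩ _ ⟨e', he', rfl⟩ hee
    simp only [hgg] at hee
    rw [hinj he he' hee]

/-- A connected edge set can be pruned to a tree of `G` using only its edges. -/
lemma exists_isTree_subgraph {G : SimpleGraph V} {F : Set (Sym2 V)} (hF : F ⊆ G.edgeSet) (x : V) :
    ∃ T : G.Subgraph, T.coe.IsTree ∧ T.edgeSet ⊆ F ∧
      ∀ y, (fromEdgeSet F).Reachable x y → y ∈ T.verts := by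
  obtain ⟨T, hTle, hT⟩ :=
    ((fromEdgeSet F).connectedComponentMk x).connected_toSimpleGraph.exists_isTree_le
  let T' : G.Subgraph :=
    { verts := ((fromEdgeSet F).connectedComponentMk x).supp
      Adj := fun a b => ∃ ha hb, T.Adj ⟨a, ha⟩ ⟨b, hb⟩
      adj_sub := by
        rintro a b ⟨ha, hb, h⟩
        have h' : (fromEdgeSet F).Adj a b := hTle h
        exact hF (fromEdgeSet_adj _ |>.1 h').1
      edge_vert := fun ⟨ha, _⟩ => ha
      symm := ⟨fun a b ⟨ha, hb, h⟩ => ⟨hb, ha, h.symm⟩⟩ }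
  refine ⟨T', ?_, ?_, ?_⟩
  · have : T'.coe = T := by
      ext ⟨a, ha⟩ ⟨b, hb⟩
      exact ⟨fun ⟨_, _, h⟩ => h, fun h => ⟨ha, hb, h⟩⟩
    rw [this]; exact hT
  · intro e he
    induction e using Sym2.ind with
    | _ a b =>
      obtain ⟨ha, hb, h⟩ := he
      have h' : (fromEdgeSet F).Adj a b := hTle h
      exact (fromEdgeSet_adj _ |>.1 h').1
  · intro y hy
    exact ConnectedComponent.sound hy.symm

lemma Subgraph.reachable_fromEdgeSet {G : SimpleGraph V} {T : G.Subgraph} (hT : T.coe.IsTree)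
    {x y : V} (hx : x ∈ T.verts) (hy : y ∈ T.verts) :
    (fromEdgeSet T.edgeSet).Reachable x y := by
  have h := hT.connected.preconnected ⟨x, hx⟩ ⟨y, hy⟩
  exact h.map (G' := fromEdgeSet T.edgeSet)
    ⟨Subtype.val, fun {a b} hab => by
      rw [fromEdgeSet_adj]; exact ⟨hab, fun h => hab.ne (Subtype.ext h)⟩⟩

/-- On at least three vertices and with at least one color, the edge-set formulation computes the
`3`-rainbow index. -/
theorem rainbowIndex_three_le_iff [Fintype V] (G : SimpleGraph V) (hV : 3 ≤ Fintype.card V) {k : ℕ}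
    (hk : 0 < k) : G.rainbowIndex 3 ≤ k ↔ G.RainbowConnectsTriples k := by
  classical
  constructor
  · intro h
    have : ∃ q ≤ k, ∃ c : G.EdgeLabeling (Fin q), IsRainbowColoring 3 c := by
      by_contra! hcon
      have : ((k + 1 : ℕ) : ℕ∞) ≤ G.rainbowIndex 3 := by
        refine le_iInf₂ fun q hq => ?_
        obtain ⟨c, hc⟩ := hq
        by_contra hlt
        exact hcon q (by rw [Nat.cast_le] at hlt; omega) c hc
      have := this.trans h
      rw [Nat.cast_le] at this
      omega
    obtain ⟨q, hq, c, hc⟩ := this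
    refine ⟨fun e => if h : e ∈ G.edgeSet then (c ⟨e, h⟩ : ℕ) else 0, fun x y z => ?_⟩
    obtain ⟨S, hS, hS3⟩ := Finset.exists_superset_card_eq (s := {x, y, z}) Finset.card_le_three hV
    obtain ⟨T, hT, hST, hr⟩ := hc S hS3
    have hx : x ∈ T.verts := hST (hS (by simp))
    refine ⟨T.edgeSet, T.edgeSet_subset, fun e he => ?_, fun e he e' he' hee => ?_,
      Subgraph.reachable_fromEdgeSet hT hx (hST (hS (by simp))),
      Subgraph.reachable_fromEdgeSet hT hx (hST (hS (by simp)))⟩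
    · dsimp only
      rw [dif_pos (T.edgeSet_subset he)]
      exact (Fin.is_lt _).trans_le hq
    · dsimp only at hee
      rw [dif_pos (T.edgeSet_subset he), dif_pos (T.edgeSet_subset he')] at hee
      exact congrArg Subtype.val (hr ⟨e, _⟩ ⟨e', _⟩ he he' (Fin.ext hee))
  · rintro ⟨c, hc⟩
    refine iInf₂_le_of_le k ⟨fun e => ⟨c e % k, Nat.mod_lt _ hk⟩, fun S hS => ?_⟩ le_rfl
    obtain ⟨x, y, z, -, -, -, rfl⟩ := Finset.card_eq_three.1 hS
    obtain ⟨F, hF, hlt, hinj, hy, hz⟩ := hc x y z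
    obtain ⟨T, hT, hTF, hTv⟩ := exists_isTree_subgraph hF x
    refine ⟨T, hT, ?_, fun e f he hf hef => ?_⟩
    · intro v hv
      simp only [Finset.coe_insert, Finset.coe_singleton, Set.mem_insert_iff,
        Set.mem_singleton_iff] at hv
      rcases hv with rfl | rfl | rfl
      · exact hTv _ (Reachable.refl _)
      · exact hTv _ hy
      · exact hTv _ hz
    · have h := Fin.mk.inj_iff.1 hef
      rw [Nat.mod_eq_of_lt (hlt _ (hTF he)), Nat.mod_eq_of_lt (hlt _ (hTF hf))] at h
      exact Subtype.ext (hinj (hTF he) (hTF hf) h)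

/-! ### Explicit colorings -/

/-- The list of edges, each written as parent and child, grows a tree from the visited vertices
`vs`: every parent has been visited earlier. -/
def GrowsFrom [DecidableEq V] : List V → List (V × V) → Bool
  | _, [] => true
  | vs, p :: t => decide (p.1 ∈ vs) && GrowsFrom (p.2 :: vs) t

lemma reachable_of_growsFrom [DecidableEq V] {H : SimpleGraph V} (r : V) :
    ∀ (t : List (V × V)) (vs : List V), GrowsFrom vs t → (∀ p ∈ t, H.Adj p.1 p.2) →
      (∀ v ∈ vs, H.Reachable r v) → ∀ v ∈ vs ++ t.map Prod.snd, H.Reachable r v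
  | [], vs, _, _, hvs, v, hv => hvs v (by simpa using hv)
  | p :: t, vs, hg, ht, hvs, v, hv => by
    simp only [GrowsFrom, Bool.and_eq_true, decide_eq_true_eq] at hg
    refine reachable_of_growsFrom r t (p.2 :: vs) hg.2 (fun q hq => ht q (by simp [hq])) ?_ v ?_
    · intro v hv
      rcases List.mem_cons.1 hv with rfl | hv
      · exact (hvs _ hg.1).trans (ht p (by simp)).reachable
      · exact hvs v hv
    · simp only [List.mem_append, List.map_cons, List.mem_cons] at hv ⊢
      tauto

/-- The color of an edge when the color classes are listed in `cls`. -/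
def classIndex [DecidableEq V] (cls : List (List (V × V))) (e : Sym2 V) : ℕ :=
  cls.findIdx fun l => decide (e ∈ l.map fun p => s(p.1, p.2))

/-- A coloring listed by its color classes, certified by rooted rainbow trees that cover all triples
of vertices. -/
lemma RainbowConnectsTriples.of_trees [DecidableEq V] {G : SimpleGraph V}
    (cls : List (List (V × V))) (trees : List (V × List (V × V)))
    (hadj : ∀ p ∈ cls.flatten, G.Adj p.1 p.2)
    (htree : ∀ t ∈ trees, GrowsFrom [t.1] t.2 ∧
      (∀ p ∈ t.2, classIndex cls s(p.1, p.2) < cls.length) ∧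
      (t.2.map fun p => classIndex cls s(p.1, p.2)).Nodup)
    (hcover : ∀ x y z : V, trees.any fun t =>
      let vs := t.1 :: t.2.map Prod.snd
      decide (x ∈ vs) && decide (y ∈ vs) && decide (z ∈ vs)) :
    G.RainbowConnectsTriples cls.length := by
  refine ⟨classIndex cls, fun x y z => ?_⟩
  obtain ⟨⟨r, t⟩, ht, h⟩ := List.any_eq_true.1 (hcover x y z)
  simp only [Bool.and_eq_true, decide_eq_true_eq] at h
  obtain ⟨⟨hx, hy⟩, hz⟩ := h
  obtain ⟨hg, hlt, hnd⟩ := htree _ ht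
  have hG : ∀ p ∈ t, G.Adj p.1 p.2 := by
    intro p hp
    have h := List.findIdx_lt_length.1 (hlt p hp)
    obtain ⟨l, hl, h⟩ := h
    simp only [decide_eq_true_eq, List.mem_map] at h
    obtain ⟨q, hq, hqp⟩ := h
    have := hadj q (List.mem_flatten.2 ⟨l, hl, hq⟩)
    rw [← mem_edgeSet, ← hqp]
    exact this
  have hr : ∀ v ∈ r :: t.map Prod.snd,
      (fromEdgeSet {e | ∃ p ∈ t, s(p.1, p.2) = e}).Reachable r v := by
    intro v hv
    refine reachable_of_growsFrom r t [r] hg (fun p hp => ?_) (by simp) v (by simpa using hv)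
    rw [fromEdgeSet_adj]
    exact ⟨⟨p, hp, rfl⟩, (hG p hp).ne⟩
  refine ⟨{e | ∃ p ∈ t, s(p.1, p.2) = e}, ?_, ?_, ?_, (hr x hx).symm.trans (hr y hy),
    (hr x hx).symm.trans (hr z hz)⟩
  · rintro _ ⟨p, hp, rfl⟩
    exact hG p hp
  · rintro _ ⟨p, hp, rfl⟩
    exact hlt p hp
  · rintro _ ⟨p, hp, rfl⟩ _ ⟨q, hq, rfl⟩ h
    rw [List.inj_on_of_nodup_map hnd hp hq h]

/-! ### Cycles with a chord or an ear -/

lemma cycleGraph_adj_iff_val {n : ℕ} (hn : 2 ≤ n) {i j : Fin n} :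
    (cycleGraph n).Adj i j ↔ i.val + 1 = j.val ∨ j.val + 1 = i.val ∨
      (i.val = 0 ∧ j.val + 1 = n) ∨ (j.val = 0 ∧ i.val + 1 = n) := by
  obtain ⟨i, hi⟩ := i
  obtain ⟨j, hj⟩ := j
  rw [cycleGraph_adj', Fin.sub_def, Fin.sub_def]
  dsimp only
  have h1 : (n - j + i) % n = if j ≤ i then i - j else n - j + i := by
    split_ifs
    · rw [show n - j + i = (i - j) + n by omega, Nat.add_mod_right, Nat.mod_eq_of_lt (by omega)]
    · rw [Nat.mod_eq_of_lt (by omega)]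
  have h2 : (n - i + j) % n = if i ≤ j then j - i else n - i + j := by
    split_ifs
    · rw [show n - i + j = (j - i) + n by omega, Nat.add_mod_right, Nat.mod_eq_of_lt (by omega)]
    · rw [Nat.mod_eq_of_lt (by omega)]
  rw [h1, h2]
  split_ifs <;> omega

/-- The cycle `C_n` with the chord from `0` to `k`. -/
def cycleWithChord (n k : ℕ) : SimpleGraph (Fin n) :=
  cycleGraph n ⊔ fromRel fun i j => i.val = 0 ∧ j.val = k

/-- The cycle `C_m` with a further vertex `none` joined to the cycle vertices `0` and `k`. -/
def cycleWithEar (m k : ℕ) : SimpleGraph (Option (Fin m)) :=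
  (cycleGraph m).map some ⊔
    fromRel fun x y => x = none ∧ ∃ i : Fin m, y = some i ∧ (i.val = 0 ∨ i.val = k)

lemma cycleWithEar_adj_some {m k : ℕ} {i j : Fin m} (h : (cycleGraph m).Adj i j) :
    (cycleWithEar m k).Adj (some i) (some j) :=
  Or.inl ⟨by simpa using h.ne, i, j, h, rfl, rfl⟩

lemma cycleWithEar_adj_none {m k : ℕ} {i : Fin m} (h : i.val = 0 ∨ i.val = k) :
    (cycleWithEar m k).Adj none (some i) :=
  Or.inr ⟨by simp, Or.inl ⟨rfl, i, rfl, h⟩⟩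

/-- To embed a cycle with a chord it suffices to embed the cycle and to check the chord. -/
lemma cycleWithChord_hom {n k : ℕ} {G : SimpleGraph V} (φ : Fin n → V)
    (hcyc : ∀ i j, (cycleGraph n).Adj i j → G.Adj (φ i) (φ j))
    (hch : ∀ i j : Fin n, i.val = 0 → j.val = k → i ≠ j → G.Adj (φ i) (φ j)) :
    ∀ i j, (cycleWithChord n k).Adj i j → G.Adj (φ i) (φ j) := by
  rintro i j (h | ⟨hne, ⟨h1, h2⟩ | ⟨h1, h2⟩⟩)
  · exact hcyc i j h
  · exact hch i j h1 h2 hne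
  · exact (hch j i h1 h2 hne.symm).symm

lemma cycleWithEar_hom {m k : ℕ} {G : SimpleGraph V} (φ : Option (Fin m) → V)
    (hcyc : ∀ i j, (cycleGraph m).Adj i j → G.Adj (φ (some i)) (φ (some j)))
    (hear : ∀ i : Fin m, i.val = 0 ∨ i.val = k → G.Adj (φ none) (φ (some i))) :
    ∀ x y, (cycleWithEar m k).Adj x y → G.Adj (φ x) (φ y) := by
  rintro x y (⟨-, i, j, h, rfl, rfl⟩ | ⟨-, ⟨rfl, i, rfl, h⟩ | ⟨rfl, i, rfl, h⟩⟩)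
  · exact hcyc i j h
  · exact hear i h
  · exact (hear i h).symm

/-- `C_(m+1)` contracts to `C_m` in such a way that `0` is kept and a vertex `k` not adjacent to `0`
is sent to a vertex not adjacent to `0`. -/
lemma exists_cycleGraph_contraction {m k : ℕ} (hm : 4 ≤ m) (hk : 2 ≤ k) (hkm : k + 2 ≤ m + 1) :
    ∃ k', 2 ≤ k' ∧ k' + 2 ≤ m ∧ ∃ (f : Fin (m + 1) → Fin m) (a b : Fin (m + 1)),
      (cycleGraph (m + 1)).Adj a b ∧ (∀ x y, f x = f y → x = y ∨ s(x, y) = s(a, b)) ∧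
      (∀ p q, (cycleGraph m).Adj p q → ∃ x y, f x = p ∧ f y = q ∧ (cycleGraph (m + 1)).Adj x y) ∧
      (∀ x, x.val = 0 → (f x).val = 0) ∧ (∀ x, x.val = k → (f x).val = k') := by
  -- it suffices to lift each cycle edge in one of its two directions
  have hsymm : ∀ f : Fin (m + 1) → Fin m,
      (∀ p q : Fin m, p.val + 1 = q.val ∨ (p.val = 0 ∧ q.val + 1 = m) →
        ∃ x y, f x = p ∧ f y = q ∧ (cycleGraph (m + 1)).Adj x y) →
      ∀ p q, (cycleGraph m).Adj p q →
        ∃ x y, f x = p ∧ f y = q ∧ (cycleGraph (m + 1)).Adj x y := by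
    intro f hf p q h
    rw [cycleGraph_adj_iff_val (by omega)] at h
    rcases h with h | h | h | h
    · exact hf p q (Or.inl h)
    · obtain ⟨x, y, hx, hy, hxy⟩ := hf q p (Or.inl h)
      exact ⟨y, x, hy, hx, hxy.symm⟩
    · exact hf p q (Or.inr h)
    · obtain ⟨x, y, hx, hy, hxy⟩ := hf q p (Or.inr h)
      exact ⟨y, x, hy, hx, hxy.symm⟩
  by_cases hcase : k + 3 ≤ m + 1
  · refine ⟨k, hk, by omega, fun i => ⟨min i.val (m - 1), by omega⟩, ⟨m - 1, by omega⟩,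
      ⟨m, by omega⟩, ?_, ?_, hsymm _ ?_, ?_, ?_⟩
    · rw [cycleGraph_adj_iff_val (by omega)]; dsimp only; omega
    · intro x y h
      simp only [Fin.mk.injEq] at h
      simp only [Sym2.eq_iff, Fin.ext_iff]
      omega
    · intro p q h
      have hp := p.isLt
      have hq := q.isLt
      rcases h with h | h
      · refine ⟨⟨p, by omega⟩, ⟨q, by omega⟩, ?_, ?_, ?_⟩
        · ext; dsimp only; omega
        · ext; dsimp only; omega
        · rw [cycleGraph_adj_iff_val (by omega)]; dsimp only; omega
      · refine ⟨⟨0, by omega⟩, ⟨m, by omega⟩, ?_, ?_, ?_⟩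
        · ext; dsimp only; omega
        · ext; dsimp only; omega
        · rw [cycleGraph_adj_iff_val (by omega)]; dsimp only; omega
    · intro x hx; dsimp only; omega
    · intro x hx; dsimp only; omega
  · refine ⟨k - 1, by omega, by omega, fun i => ⟨if i.val ≤ 1 then i.val else i.val - 1, by
      split_ifs <;> omega⟩, ⟨1, by omega⟩,
      ⟨2, by omega⟩, ?_, ?_, hsymm _ ?_, ?_, ?_⟩
    · rw [cycleGraph_adj_iff_val (by omega)]; dsimp only; omega
    · intro x y h
      simp only [Fin.mk.injEq] at h
      simp only [Sym2.eq_iff, Fin.ext_iff]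
      split_ifs at h <;> omega
    · intro p q h
      have hp := p.isLt
      have hq := q.isLt
      by_cases h0 : p.val + 1 = q.val ∧ p.val = 0
      · refine ⟨⟨0, by omega⟩, ⟨1, by omega⟩, ?_, ?_, ?_⟩
        · ext; simp only; split_ifs <;> omega
        · ext; simp only; split_ifs <;> omega
        · rw [cycleGraph_adj_iff_val (by omega)]; dsimp only; omega
      · refine ⟨⟨if p.val = 0 then 0 else p.val + 1, by split_ifs <;> omega⟩,
          ⟨q.val + 1, by omega⟩, ?_, ?_, ?_⟩
        · ext; simp only; split_ifs <;> omega
        · ext; simp only; split_ifs <;> omega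
        · rw [cycleGraph_adj_iff_val (by omega)]; dsimp only; split_ifs <;> omega
    · intro x hx; dsimp only; split_ifs <;> omega
    · intro x hx; dsimp only; split_ifs <;> omega

lemma cycleWithChord_adj {n k : ℕ} {i j : Fin n} : (cycleWithChord n k).Adj i j ↔
    (cycleGraph n).Adj i j ∨ i ≠ j ∧ (i.val = 0 ∧ j.val = k ∨ j.val = 0 ∧ i.val = k) := by
  rw [cycleWithChord, sup_adj, fromRel_adj]

lemma rainbowConnectsTriples_cycleWithEar_five_two :
    (cycleWithEar 5 2).RainbowConnectsTriples 3 := by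
  refine RainbowConnectsTriples.of_trees
    [[(some 0, some 1), (some 2, some 3)],
      [(some 1, some 2), (some 3, some 4), (none, some 0)],
      [(some 4, some 0), (none, some 2)]]
    [(some 0, [(some 0, some 1), (some 1, some 2), (some 0, some 4)]),
      (some 0, [(some 0, none), (none, some 2), (some 2, some 3)]),
      (some 0, [(some 0, some 1), (some 0, some 4), (some 4, some 3)]),
      (some 0, [(some 0, some 1), (some 0, some 4), (some 0, none)]),
      (some 1, [(some 1, some 2), (some 2, some 3), (some 2, none)]),
      (some 2, [(some 2, some 3), (some 3, some 4), (some 2, none)])] ?_ ?_ ?_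
  · simp [cycleWithEar_adj_some, cycleWithEar_adj_none, cycleGraph_adj_iff_val]
  · decide
  · decide

lemma rainbowConnectsTriples_cycleWithEar_five_three :
    (cycleWithEar 5 3).RainbowConnectsTriples 3 := by
  refine RainbowConnectsTriples.of_trees
    [[(some 0, some 1), (some 2, some 3)],
      [(some 1, some 2), (some 3, some 4), (none, some 0)],
      [(some 4, some 0), (none, some 3)]]
    [(some 0, [(some 0, some 1), (some 1, some 2), (some 0, some 4)]),
      (some 0, [(some 0, some 1), (some 0, none), (none, some 3)]),
      (some 2, [(some 2, some 3), (some 3, some 4), (some 3, none)]),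
      (some 0, [(some 0, some 1), (some 0, some 4), (some 4, some 3)]),
      (some 0, [(some 0, some 1), (some 0, some 4), (some 0, none)]),
      (some 0, [(some 0, none), (none, some 3), (some 3, some 2)]),
      (some 1, [(some 1, some 2), (some 2, some 3), (some 3, none)])] ?_ ?_ ?_
  · simp [cycleWithEar_adj_some, cycleWithEar_adj_none, cycleGraph_adj_iff_val]
  · decide
  · decide

lemma rainbowConnectsTriples_cycleWithChord_seven_two :
    (cycleWithChord 7 2).RainbowConnectsTriples 4 := by
  refine RainbowConnectsTriples.of_trees
    [[(0, 1), (2, 3)],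
      [(1, 2), (5, 6)],
      [(3, 4), (6, 0)],
      [(4, 5), (0, 2)]]
    [(0, [(0, 1), (0, 6), (6, 5), (5, 4)]),
      (0, [(0, 6), (6, 5), (0, 2), (2, 3)]),
      (0, [(0, 2), (2, 1), (2, 3), (3, 4)]),
      (1, [(1, 2), (2, 3), (3, 4), (4, 5)]),
      (0, [(0, 6), (0, 2), (2, 1), (2, 3)]),
      (2, [(2, 3), (3, 4), (4, 5), (5, 6)])] ?_ ?_ ?_
  · simp [cycleWithChord_adj, cycleGraph_adj_iff_val]
  · decide
  · decide

lemma rainbowConnectsTriples_cycleWithChord_seven_three :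
    (cycleWithChord 7 3).RainbowConnectsTriples 4 := by
  refine RainbowConnectsTriples.of_trees
    [[(0, 1), (2, 3)],
      [(1, 2), (4, 5)],
      [(3, 4), (6, 0)],
      [(5, 6), (0, 3)]]
    [(0, [(0, 1), (1, 2), (0, 6), (6, 5)]),
      (0, [(0, 1), (1, 2), (0, 3), (3, 4)]),
      (2, [(2, 3), (3, 4), (4, 5), (5, 6)]),
      (0, [(0, 1), (0, 6), (6, 5), (5, 4)]),
      (0, [(0, 1), (1, 2), (0, 6), (0, 3)]),
      (0, [(0, 1), (0, 3), (3, 4), (4, 5)])] ?_ ?_ ?_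
  · simp [cycleWithChord_adj, cycleGraph_adj_iff_val]
  · decide
  · decide

lemma rainbowConnectsTriples_cycleWithChord_seven_four :
    (cycleWithChord 7 4).RainbowConnectsTriples 4 := by
  refine RainbowConnectsTriples.of_trees
    [[(0, 1), (3, 4)],
      [(1, 2), (5, 6)],
      [(2, 3), (0, 4)],
      [(4, 5), (6, 0)]]
    [(0, [(0, 1), (1, 2), (2, 3), (0, 6)]),
      (0, [(0, 1), (1, 2), (0, 4), (4, 5)]),
      (0, [(0, 6), (6, 5), (0, 4), (4, 3)]),
      (1, [(1, 2), (2, 3), (3, 4), (4, 5)]),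
      (0, [(0, 1), (1, 2), (0, 6), (0, 4)]),
      (0, [(0, 1), (0, 6), (6, 5), (0, 4)]),
      (2, [(2, 3), (3, 4), (4, 5), (5, 6)])] ?_ ?_ ?_
  · simp [cycleWithChord_adj, cycleGraph_adj_iff_val]
  · decide
  · decide

lemma rainbowConnectsTriples_cycleWithChord_seven_five :
    (cycleWithChord 7 5).RainbowConnectsTriples 4 := by
  refine RainbowConnectsTriples.of_trees
    [[(0, 1), (3, 4)],
      [(1, 2), (5, 6)],
      [(2, 3), (0, 5)],
      [(4, 5), (6, 0)]]
    [(0, [(0, 1), (1, 2), (2, 3), (0, 6)]),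
      (0, [(0, 1), (1, 2), (0, 5), (5, 4)]),
      (0, [(0, 5), (5, 4), (4, 3), (5, 6)]),
      (1, [(1, 2), (2, 3), (3, 4), (4, 5)]),
      (0, [(0, 1), (1, 2), (0, 6), (0, 5)]),
      (0, [(0, 1), (0, 5), (5, 4), (5, 6)]),
      (2, [(2, 3), (3, 4), (4, 5), (5, 6)])] ?_ ?_ ?_
  · simp [cycleWithChord_adj, cycleGraph_adj_iff_val]
  · decide
  · decide

lemma rainbowConnectsTriples_cycleWithChord_six_three :
    (cycleWithChord 6 3).RainbowConnectsTriples 3 := by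
  refine RainbowConnectsTriples.of_trees
    [[(0, 1), (2, 3)],
      [(1, 2), (4, 5), (0, 3)],
      [(3, 4), (5, 0)]]
    [(0, [(0, 1), (1, 2), (0, 5)]),
      (0, [(0, 1), (0, 3), (3, 4)]),
      (2, [(2, 3), (3, 4), (4, 5)]),
      (0, [(0, 1), (0, 5), (5, 4)]),
      (0, [(0, 1), (0, 5), (0, 3)]),
      (0, [(0, 3), (3, 2), (3, 4)]),
      (1, [(1, 2), (2, 3), (3, 4)])] ?_ ?_ ?_
  · simp [cycleWithChord_adj, cycleGraph_adj_iff_val]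
  · decide
  · decide

lemma rainbowConnectsTriples_cycleGraph_four :
    (cycleGraph 4).RainbowConnectsTriples 2 := by
  refine RainbowConnectsTriples.of_trees
    [[(0, 1), (2, 3)],
      [(1, 2), (3, 0)]]
    [(0, [(0, 1), (1, 2)]),
      (0, [(0, 1), (0, 3)]),
      (0, [(0, 3), (3, 2)]),
      (1, [(1, 2), (2, 3)])] ?_ ?_ ?_
  · simp [cycleGraph_adj_iff_val]
  · decide
  · decide

lemma rainbowConnectsTriples_top_five :
    (⊤ : SimpleGraph (Fin 5)).RainbowConnectsTriples 2 := by
  refine RainbowConnectsTriples.of_trees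
    [[(0, 1), (0, 2), (1, 3), (2, 4), (3, 4)],
      [(0, 3), (0, 4), (1, 2), (1, 4), (2, 3)]]
    [(0, [(0, 1), (0, 3)]),
      (0, [(0, 1), (0, 4)]),
      (0, [(0, 1), (1, 2)]),
      (0, [(0, 2), (0, 3)]),
      (0, [(0, 2), (0, 4)]),
      (0, [(0, 3), (3, 4)]),
      (1, [(1, 2), (1, 3)]),
      (1, [(1, 2), (2, 4)]),
      (1, [(1, 3), (1, 4)]),
      (2, [(2, 3), (2, 4)])] ?_ ?_ ?_
  · simp
  · decide
  · decide

/-- A six-cycle with two crossing short chords needs only three colors. -/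
lemma rainbowConnectsTriples_of_crossing_chords {G : SimpleGraph (Fin 6)}
    (hG : cycleGraph 6 ≤ G) (h₁ : G.Adj 0 2) (h₂ : G.Adj 1 3) : G.RainbowConnectsTriples 3 := by
  refine RainbowConnectsTriples.of_trees
    [[(0, 1), (1, 2), (2, 3), (4, 5)],
      [(3, 4), (5, 0)],
      [(0, 2), (1, 3)]]
    [(0, [(0, 1), (0, 5), (0, 2)]),
      (0, [(0, 1), (1, 3), (3, 4)]),
      (0, [(0, 5), (5, 4), (0, 2)]),
      (0, [(0, 5), (0, 2), (2, 3)]),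
      (1, [(1, 2), (1, 3), (3, 4)]),
      (1, [(1, 3), (3, 4), (4, 5)])] ?_ ?_ ?_
  · have hadj {i j : Fin 6} (h : (cycleGraph 6).Adj i j) : G.Adj i j := hG h
    simp [hadj, h₁, h₂, cycleGraph_adj_iff_val]
  · decide
  · decide

/-- A six-cycle with two short chords cutting off opposite vertices needs only three colors. -/
lemma rainbowConnectsTriples_of_parallel_chords {G : SimpleGraph (Fin 6)}
    (hG : cycleGraph 6 ≤ G) (h₁ : G.Adj 0 2) (h₂ : G.Adj 3 5) : G.RainbowConnectsTriples 3 := by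
  refine RainbowConnectsTriples.of_trees
    [[(0, 1), (2, 3)],
      [(1, 2), (4, 5), (0, 2), (3, 5)],
      [(3, 4), (5, 0)]]
    [(0, [(0, 1), (1, 2), (0, 5)]),
      (0, [(0, 2), (2, 3), (3, 4)]),
      (0, [(0, 1), (0, 5), (5, 4)]),
      (0, [(0, 1), (0, 5), (5, 3)]),
      (1, [(1, 2), (2, 3), (3, 4)]),
      (2, [(2, 3), (3, 4), (4, 5)])] ?_ ?_ ?_
  · have hadj {i j : Fin 6} (h : (cycleGraph 6).Adj i j) : G.Adj i j := hG h
    simp [hadj, h₁, h₂, cycleGraph_adj_iff_val]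
  · decide
  · decide

/-- `K_{2,4}` with the parts `{0, 1}` and `{2, 3, 4, 5}` needs only three colors. -/
lemma rainbowConnectsTriples_of_two_by_four {G : SimpleGraph (Fin 6)}
    (h₀ : ∀ i : Fin 6, 2 ≤ i.val → G.Adj 0 i) (h₁ : ∀ i : Fin 6, 2 ≤ i.val → G.Adj 1 i) :
    G.RainbowConnectsTriples 3 := by
  refine RainbowConnectsTriples.of_trees
    [[(0, 2), (0, 3), (1, 4), (1, 5)],
      [(0, 4), (1, 2)],
      [(0, 5), (1, 3)]]
    [(0, [(0, 2), (0, 4), (0, 5)]),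
      (0, [(0, 2), (2, 1), (1, 3)]),
      (0, [(0, 3), (0, 4), (0, 5)]),
      (0, [(0, 4), (0, 5), (4, 1)]),
      (1, [(1, 2), (1, 3), (1, 4)]),
      (1, [(1, 2), (1, 3), (1, 5)])] ?_ ?_ ?_
  · simp [h₀, h₁]
  · decide
  · decide

/-- A cycle with an ear of length two over at least five cycle vertices can be colored with three
colors fewer than it has vertices, since it contracts to such a graph over the five-cycle. -/
lemma rainbowConnectsTriples_cycleWithEar {m : ℕ} (hm : 5 ≤ m) {k : ℕ} (hk : 2 ≤ k)
    (hkm : k + 2 ≤ m) : (cycleWithEar m k).RainbowConnectsTriples (m - 2) := by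
  induction m, hm using Nat.le_induction generalizing k with
  | base =>
    obtain rfl | rfl : k = 2 ∨ k = 3 := by omega
    · exact rainbowConnectsTriples_cycleWithEar_five_two
    · exact rainbowConnectsTriples_cycleWithEar_five_three
  | succ m hm ih =>
    obtain ⟨k', hk', hkm', f, a, b, hab, hfib, hlift, h0, hfk⟩ :=
      exists_cycleGraph_contraction (by omega : 4 ≤ m) hk hkm
    have := RainbowConnectsTriples.of_contract (G := cycleWithEar (m + 1) k) (Option.map f)
      (cycleWithEar_adj_some hab) ?_ ?_ (ih hk' hkm')
    · rwa [show m - 2 + 1 = m + 1 - 2 by omega] at this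
    · rintro (_ | x) (_ | y) h
      · exact Or.inl rfl
      · simp at h
      · simp at h
      · simp only [Option.map_some, Option.some.injEq] at h
        rcases hfib x y h with rfl | h
        · exact Or.inl rfl
        · right
          simp only [Sym2.eq_iff] at h
          rcases h with ⟨rfl, rfl⟩ | ⟨rfl, rfl⟩
          · rfl
          · exact Sym2.eq_swap
    · have hear : ∀ p : Fin m, p.val = 0 ∨ p.val = k' →
          ∃ i, f i = p ∧ (cycleWithEar (m + 1) k).Adj none (some i) := by
        rintro p (h | h)
        · exact ⟨⟨0, by omega⟩, Fin.ext (by rw [h0 _ rfl, h]), cycleWithEar_adj_none (Or.inl rfl)⟩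
        · exact ⟨⟨k, by omega⟩, Fin.ext (by rw [hfk _ rfl, h]), cycleWithEar_adj_none (Or.inr rfl)⟩
      rintro p q (⟨-, p, q, h, rfl, rfl⟩ | ⟨-, ⟨rfl, i, rfl, h⟩ | ⟨rfl, i, rfl, h⟩⟩)
      · obtain ⟨x, y, rfl, rfl, hxy⟩ := hlift p q h
        exact ⟨some x, some y, rfl, rfl, cycleWithEar_adj_some hxy⟩
      · obtain ⟨x, rfl, hx⟩ := hear i h
        exact ⟨none, some x, rfl, rfl, hx⟩
      · obtain ⟨x, rfl, hx⟩ := hear i h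
        exact ⟨some x, none, rfl, rfl, hx.symm⟩

/-- A cycle with a chord on at least seven vertices can be colored with three colors fewer than it
has vertices, since it contracts to a seven-cycle with a chord. -/
lemma rainbowConnectsTriples_cycleWithChord {n : ℕ} (hn : 7 ≤ n) {k : ℕ} (hk : 2 ≤ k)
    (hkn : k + 2 ≤ n) : (cycleWithChord n k).RainbowConnectsTriples (n - 3) := by
  induction n, hn using Nat.le_induction generalizing k with
  | base =>
    obtain rfl | rfl | rfl | rfl : k = 2 ∨ k = 3 ∨ k = 4 ∨ k = 5 := by omega
    · exact rainbowConnectsTriples_cycleWithChord_seven_two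
    · exact rainbowConnectsTriples_cycleWithChord_seven_three
    · exact rainbowConnectsTriples_cycleWithChord_seven_four
    · exact rainbowConnectsTriples_cycleWithChord_seven_five
  | succ m hm ih =>
    obtain ⟨k', hk', hkm', f, a, b, hab, hfib, hlift, h0, hfk⟩ :=
      exists_cycleGraph_contraction (by omega : 4 ≤ m) hk hkn
    have := RainbowConnectsTriples.of_contract (G := cycleWithChord (m + 1) k) f
      (Or.inl hab) hfib ?_ (ih hk' hkm')
    · rwa [show m - 3 + 1 = m + 1 - 3 by omega] at this
    · have hch : ∀ p q : Fin m, p.val = 0 → q.val = k' →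
          ∃ x y, f x = p ∧ f y = q ∧ (cycleWithChord (m + 1) k).Adj x y := fun p q hp hq =>
        ⟨⟨0, by omega⟩, ⟨k, by omega⟩, Fin.ext (by rw [h0 _ rfl, hp]),
          Fin.ext (by rw [hfk _ rfl, hq]),
          cycleWithChord_adj.2 (Or.inr ⟨by simp [Fin.ext_iff]; omega, Or.inl ⟨rfl, rfl⟩⟩)⟩
      intro p q h
      rcases cycleWithChord_adj.1 h with h | ⟨-, ⟨hp, hq⟩ | ⟨hq, hp⟩⟩
      · obtain ⟨x, y, hx, hy, hxy⟩ := hlift p q h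
        exact ⟨x, y, hx, hy, Or.inl hxy⟩
      · exact hch p q hp hq
      · obtain ⟨x, y, hx, hy, hxy⟩ := hch q p hq hp
        exact ⟨y, x, hy, hx, hxy.symm⟩

/-! ### Contracting an edge of a 2-connected graph -/

/-- A graph is connected if it is the image of a connected graph under a map that sends every edge
to an edge or to a single vertex. -/
lemma Connected.of_surjective {G : SimpleGraph V} {H : SimpleGraph W} (hG : G.Connected) (f : V → W)
    (hf : Function.Surjective f) (h : ∀ a b, G.Adj a b → f a = f b ∨ H.Adj (f a) (f b)) :
    H.Connected := by
  have := hG.nonempty.map f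
  refine ⟨fun p q => ?_⟩
  obtain ⟨x, rfl⟩ := hf p
  obtain ⟨y, rfl⟩ := hf q
  obtain ⟨w⟩ := hG.preconnected x y
  induction w with
  | nil => rfl
  | cons hadj w ih =>
    rcases h _ _ hadj with h | h
    · rw [h]; exact ih
    · exact h.reachable.trans ih

/-- The contraction of the edge `uw`, with `u` standing for the merged vertex. -/
def contractInto (G : SimpleGraph V) (u w : V) : SimpleGraph {x : V // x ≠ w} :=
  fromRel fun x y => G.Adj x y ∨ ((x : V) = u ∧ G.Adj w y)

lemma contractInto_adj {G : SimpleGraph V} {u w : V} {x y : {x : V // x ≠ w}} :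
    (G.contractInto u w).Adj x y ↔ x ≠ y ∧
      (G.Adj x y ∨ ((x : V) = u ∧ G.Adj w y) ∨ ((y : V) = u ∧ G.Adj w x)) := by
  rw [contractInto, fromRel_adj, G.adj_comm y x]
  tauto

lemma RainbowConnectsTriples.of_contractInto {G : SimpleGraph V} {u w : V} (huw : G.Adj u w) {k : ℕ}
    (h : (G.contractInto u w).RainbowConnectsTriples k) : G.RainbowConnectsTriples (k + 1) := by
  classical
  refine h.of_contract (fun x => if h : x = w then ⟨u, huw.ne⟩ else ⟨x, h⟩) huw ?_ ?_
  · intro x y h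
    by_cases hx : x = w <;> by_cases hy : y = w
    · exact Or.inl (hx.trans hy.symm)
    · simp only [hx, hy, dite_true, dite_false, Subtype.mk.injEq] at h
      exact Or.inr (by rw [hx, ← h, Sym2.eq_swap])
    · simp only [hx, hy, dite_true, dite_false, Subtype.mk.injEq] at h
      exact Or.inr (by rw [hy, h])
    · simp only [hx, hy, dite_false, Subtype.mk.injEq] at h
      exact Or.inl h
  · rintro ⟨p, hp⟩ ⟨q, hq⟩ h
    rw [contractInto_adj] at h
    rcases h.2 with h' | ⟨rfl, h'⟩ | ⟨rfl, h'⟩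
    · exact ⟨p, q, by simp [hp], by simp [hq], h'⟩
    · exact ⟨w, q, by simp, by simp [hq], h'⟩
    · exact ⟨p, w, by simp [hp], by simp, h'.symm⟩

lemma IsTwoConnected.exists_adj_ne [Fintype V] {G : SimpleGraph V} (hG : G.IsTwoConnected)
    {u w : V} (huw : u ≠ w) : ∃ x, G.Adj u x ∧ x ≠ w := by
  classical
  obtain ⟨z, hz⟩ := Finset.exists_mem_notMem_of_card_lt_card
    (s := {u, w}) (t := Finset.univ) (Finset.card_le_two.trans_lt hG.three_le_card)
  simp only [Finset.mem_insert, Finset.mem_singleton, not_or] at hz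
  obtain ⟨p⟩ := (hG.connected_delete w).preconnected ⟨u, huw⟩ ⟨z, hz.2.2⟩
  cases p with
  | nil => exact absurd rfl hz.2.1
  | @cons _ b _ h _ => exact ⟨b, h, b.2⟩

/-- Every vertex `u` of a 2-connected graph lies on an edge `uw` whose ends do not separate the
graph. Take a neighbor `w` of `u` as far as possible from a fixed vertex `r` in `G - u`: a component
of `G - u - w` avoiding `r` would contain a neighbor of `u` that is still farther away. -/
theorem IsTwoConnected.exists_adj_connected_induce [Fintype V] {G : SimpleGraph V}
    (hG : G.IsTwoConnected) (u : V) : ∃ w, G.Adj u w ∧ (G.induce {u, w}ᶜ).Connected := by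
  classical
  obtain ⟨r⟩ := (hG.connected_delete u).nonempty
  have hne : ∃ w : ({u}ᶜ : Set V), G.Adj u w := by
    obtain ⟨x, hx, -⟩ := hG.exists_adj_ne (u := u) (w := r) (fun h => r.2 h.symm)
    exact ⟨⟨x, hx.ne'⟩, hx⟩
  obtain ⟨w, hw, hmax⟩ := Set.exists_max_image {w : ({u}ᶜ : Set V) | G.Adj u w}
    (fun w => (G.induce {u}ᶜ).dist r w) (Set.toFinite _) hne
  obtain ⟨w, hwu⟩ := w
  change G.Adj u w at hw
  refine ⟨w, hw, ?_⟩
  -- `u` has a neighbor other than `w`, so the maximal distance is positive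
  have hrw : (r : V) ≠ w := by
    intro hrw
    obtain ⟨x, hx, hxw⟩ := hG.exists_adj_ne hw.ne
    have h := hmax ⟨x, hx.ne'⟩ hx
    have h0 : r = ⟨w, hwu⟩ := Subtype.ext hrw
    rw [← h0, dist_self, Nat.le_zero, (hG.connected_delete u).dist_eq_zero_iff] at h
    exact hxw (by rw [← hrw, h])
  have hrK : (r : V) ∈ ({u, w}ᶜ : Set V) := by
    simp only [Set.mem_compl_iff, Set.mem_insert_iff, Set.mem_singleton_iff, not_or]
    exact ⟨r.2, hrw⟩
  have hexit : ∀ (y : ({w}ᶜ : Set V)) (_ : (G.induce {w}ᶜ).Walk y ⟨u, hw.ne⟩) (hy : (y : V) ≠ u),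
      ∃ (x : V) (hx : x ∈ ({u, w}ᶜ : Set V)), G.Adj u x ∧
        (G.induce {u, w}ᶜ).Reachable ⟨y, fun h => h.elim hy y.2⟩ ⟨x, hx⟩ := by
    intro y p
    generalize hz : (⟨u, hw.ne⟩ : ({w}ᶜ : Set V)) = z at p
    induction p with
    | nil => intro hy; exact absurd (congrArg Subtype.val hz).symm hy
    | @cons a b _ hadj p ih =>
      intro hy
      by_cases hb : (b : V) = u
      · have hadj' : G.Adj a b := hadj
        exact ⟨a, fun h => h.elim hy a.2, by rw [← hb]; exact hadj'.symm, Reachable.refl _⟩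
      · obtain ⟨x, hx, hux, hbx⟩ := ih hz hb
        refine ⟨x, hx, hux, Reachable.trans (Adj.reachable ?_) hbx⟩
        exact hadj
  have hmain : ∀ y : ({u, w}ᶜ : Set V), (G.induce {u, w}ᶜ).Reachable y ⟨r, hrK⟩ := by
    rintro ⟨y, hy⟩
    have hy' := hy
    simp only [Set.mem_compl_iff, Set.mem_insert_iff, Set.mem_singleton_iff, not_or] at hy'
    obtain ⟨p⟩ := (hG.connected_delete w).preconnected ⟨y, hy'.2⟩ ⟨u, hw.ne⟩
    obtain ⟨x, hx, hux, hyx⟩ := hexit _ p hy'.1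
    refine hyx.trans (Reachable.symm ?_)
    have hx' := hx
    simp only [Set.mem_compl_iff, Set.mem_insert_iff, Set.mem_singleton_iff, not_or] at hx'
    obtain ⟨q, hq⟩ := (hG.connected_delete u).exists_walk_length_eq_dist r ⟨x, hx'.1⟩
    by_cases hwq : (⟨w, hwu⟩ : ({u}ᶜ : Set V)) ∈ q.support
    · exfalso
      have h1 := hmax ⟨x, hx'.1⟩ hux
      have h2 := dist_le (q.takeUntil _ hwq)
      have h3 := Walk.length_takeUntil_lt_length hwq (fun h => hx'.2 (congrArg Subtype.val h).symm)
      omega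
    · have hq' : ∀ v ∈ (q.map (Embedding.induce _).toHom).support, v ∈ ({u, w}ᶜ : Set V) := by
        intro v hv
        simp only [Walk.support_map, List.mem_map] at hv
        obtain ⟨v, hv, rfl⟩ := hv
        simp only [Set.mem_compl_iff, Set.mem_insert_iff, Set.mem_singleton_iff, not_or]
        refine ⟨v.2, fun h => hwq ?_⟩
        have : v = ⟨w, hwu⟩ := Subtype.ext h
        rwa [← this]
      exact ⟨(q.map (Embedding.induce _).toHom).induce _ hq'⟩
  have : Nonempty ({u, w}ᶜ : Set V) := ⟨⟨r, hrK⟩⟩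
  exact ⟨fun a b => (hmain a).trans (hmain b).symm⟩

lemma IsTwoConnected.contractInto [Fintype V] {G : SimpleGraph V} (hG : G.IsTwoConnected)
    (hV : 4 ≤ Fintype.card V) {u w : V} (huw : G.Adj u w) (hconn : (G.induce {u, w}ᶜ).Connected)
    [Fintype {x : V // x ≠ w}] : (G.contractInto u w).IsTwoConnected := by
  classical
  let f : V → {x : V // x ≠ w} := fun x => if h : x = w then ⟨u, huw.ne⟩ else ⟨x, h⟩
  have hfw : f w = ⟨u, huw.ne⟩ := by simp [f]
  have hf : ∀ x (hx : x ≠ w), f x = ⟨x, hx⟩ := fun x hx => by simp [f, hx]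
  have hadj : ∀ a b, G.Adj a b → f a = f b ∨ (G.contractInto u w).Adj (f a) (f b) := by
    intro a b hab
    by_cases hab' : f a = f b
    · exact Or.inl hab'
    refine Or.inr (contractInto_adj.2 ⟨hab', ?_⟩)
    by_cases ha : a = w
    · subst ha
      rw [hfw, hf b hab.ne']
      exact Or.inr (Or.inl ⟨rfl, hab⟩)
    · by_cases hb : b = w
      · subst hb
        rw [hfw, hf a ha]
        exact Or.inr (Or.inr ⟨rfl, hab.symm⟩)
      · rw [hf a ha, hf b hb]
        exact Or.inl hab
  refine ⟨?_, hG.connected.of_surjective f (fun x => ⟨x, hf x x.2⟩) hadj, ?_⟩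
  · rw [Fintype.card_subtype_compl, Fintype.card_subtype_eq]
    omega
  · rintro ⟨v, hv⟩
    by_cases hvu : v = u
    · subst hvu
      refine hconn.of_surjective (fun x => ⟨⟨x, fun h => x.2 (by simp [h])⟩, fun h => x.2 (by
        have : (x : V) = v := congrArg Subtype.val h
        simp [this])⟩) ?_ ?_
      · rintro ⟨⟨x, hx⟩, hxv⟩
        refine ⟨⟨x, ?_⟩, rfl⟩
        simp only [Set.mem_compl_iff, Set.mem_insert_iff, Set.mem_singleton_iff, not_or]
        exact ⟨fun h => hxv (Subtype.ext h), hx⟩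
      · intro a b hab
        have hab' : G.Adj a b := hab
        refine Or.inr (contractInto_adj.2 ⟨fun h => hab'.ne ?_, Or.inl hab'⟩)
        exact congrArg (fun x : {x : V // x ≠ w} => (x : V)) h
    · have hfv : ∀ x, x ≠ v → f x ≠ ⟨v, hv⟩ := by
        intro x hx h
        by_cases hxw : x = w
        · rw [hxw, hfw] at h
          exact hvu (congrArg Subtype.val h).symm
        · rw [hf x hxw] at h
          exact hx (congrArg Subtype.val h)
      refine (hG.connected_delete v).of_surjective (fun x => ⟨f x, hfv x x.2⟩) ?_ ?_
      · rintro ⟨⟨x, hx⟩, hxv⟩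
        exact ⟨⟨x, fun h => hxv (Subtype.ext h)⟩, Subtype.ext (hf x hx)⟩
      · intro a b hab
        rcases hadj a b hab with h | h
        · exact Or.inl (Subtype.ext h)
        · exact Or.inr h

/-! ### Undoing a contraction onto a Hamiltonian graph -/

lemma cycleGraph_hom {n : ℕ} (hn : 2 ≤ n) {G : SimpleGraph V} (φ : Fin n → V)
    (hstep : ∀ i j : Fin n, i.val + 1 = j.val → G.Adj (φ i) (φ j))
    (hclose : ∀ i j : Fin n, i.val = 0 → j.val + 1 = n → G.Adj (φ i) (φ j)) :
    ∀ i j, (cycleGraph n).Adj i j → G.Adj (φ i) (φ j) := by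
  intro i j h
  rcases (cycleGraph_adj_iff_val hn).1 h with h | h | h | h
  · exact hstep i j h
  · exact (hstep j i h).symm
  · exact hclose i j h.1 h.2
  · exact (hclose j i h.1 h.2).symm

/-- The family `e` lists, without repetition, all vertices other than `w`. -/
structure ListsAllBut {m : ℕ} (e : Fin m → V) (w : V) : Prop where
  injective : Function.Injective e
  ne : ∀ i, e i ≠ w
  cover : ∀ x, x = w ∨ ∃ i, e i = x

lemma ListsAllBut.cycleGraph_isSpanningSubgraphOf {G : SimpleGraph V} {m : ℕ} (hm : 2 ≤ m)
    {e : Fin m → V} {w : V} (he : ListsAllBut e w)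
    (hpath : ∀ i j : Fin m, i.val + 1 = j.val → G.Adj (e i) (e j))
    (h0 : ∀ i : Fin m, i.val = 0 → G.Adj w (e i))
    (hlast : ∀ i : Fin m, i.val + 1 = m → G.Adj w (e i)) :
    (cycleGraph (m + 1)).IsSpanningSubgraphOf G := by
  let φ : Fin (m + 1) → V := fun i => if h : i.val < m then e ⟨i, h⟩ else w
  have hφ : Function.Bijective φ := by
    constructor
    · intro i j h
      simp only [φ] at h
      split_ifs at h with h1 h2 h2
      · exact Fin.ext (Fin.mk.inj_iff.1 (he.injective h))
      · exact absurd h (he.ne _)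
      · exact absurd h.symm (he.ne _)
      · ext; omega
    · intro x
      rcases he.cover x with rfl | ⟨i, rfl⟩
      · exact ⟨⟨m, by omega⟩, by simp [φ]⟩
      · exact ⟨⟨i, by omega⟩, by simp [φ]⟩
  refine ⟨Equiv.ofBijective φ hφ, cycleGraph_hom (by omega) φ ?_ ?_⟩
  · intro i j h
    simp only [φ]
    rw [dif_pos (by omega)]
    split_ifs with h1
    · exact hpath _ _ h
    · exact (hlast _ (by dsimp only; omega)).symm
  · intro i j hi hj
    simp only [φ]
    rw [dif_pos (by omega), dif_neg (by omega)]
    exact (h0 _ hi).symm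

lemma ListsAllBut.cycleWithEar_isSpanningSubgraphOf {G : SimpleGraph V} {m : ℕ} {e : Fin m → V}
    {w : V} (he : ListsAllBut e w) (hcyc : ∀ i j, (cycleGraph m).Adj i j → G.Adj (e i) (e j))
    {k : ℕ} (hear : ∀ i : Fin m, i.val = 0 ∨ i.val = k → G.Adj w (e i)) :
    (cycleWithEar m k).IsSpanningSubgraphOf G := by
  let φ : Option (Fin m) → V := fun x => x.elim w e
  have hφ : Function.Bijective φ := by
    constructor
    · rintro (_ | i) (_ | j) h
      · rfl
      · exact absurd h.symm (he.ne _)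
      · exact absurd h (he.ne _)
      · exact congrArg some (he.injective h)
    · intro x
      rcases he.cover x with rfl | ⟨i, rfl⟩
      · exact ⟨none, rfl⟩
      · exact ⟨some i, rfl⟩
  exact ⟨Equiv.ofBijective φ hφ, cycleWithEar_hom φ hcyc hear⟩

/-- Let `w` be adjacent to the first vertex of the list `e`, let the other vertices of `e` form a
path, and let each end of that path be adjacent to `w` or to the first vertex. If the first vertex
takes the left end, then either `w` takes the right end and closes a Hamiltonian cycle, or `e` is a
cycle; in that case a second neighbor of `w` allows to insert `w` into the cycle or makes it an ear
over the cycle. -/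
lemma ListsAllBut.cycle_or_ear {G : SimpleGraph V} {m : ℕ} (hm : 3 ≤ m) {e : Fin m → V} {w : V}
    (he : ListsAllBut e w)
    (hpath : ∀ i j : Fin m, i.val ≠ 0 → i.val + 1 = j.val → G.Adj (e i) (e j))
    (h0 : ∀ i : Fin m, i.val = 0 → G.Adj w (e i))
    (h01 : ∀ i j : Fin m, i.val = 0 → j.val = 1 → G.Adj (e i) (e j))
    (hlast : ∀ i j : Fin m, i.val = 0 → j.val + 1 = m → G.Adj (e i) (e j) ∨ G.Adj w (e j))
    (hw : ∃ i : Fin m, i.val ≠ 0 ∧ G.Adj w (e i)) :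
    (cycleGraph (m + 1)).IsSpanningSubgraphOf G ∨
      ∃ k, 2 ≤ k ∧ k + 2 ≤ m ∧ (cycleWithEar m k).IsSpanningSubgraphOf G := by
  have hpath' : ∀ i j : Fin m, i.val + 1 = j.val → G.Adj (e i) (e j) := by
    intro i j hij
    by_cases hi : i.val = 0
    · exact h01 i j hi (by omega)
    · exact hpath i j hi hij
  by_cases hwl : ∀ i : Fin m, i.val + 1 = m → G.Adj w (e i)
  · exact Or.inl (he.cycleGraph_isSpanningSubgraphOf (by omega) hpath' h0 hwl)
  push Not at hwl
  obtain ⟨l, hl, hwl⟩ := hwl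
  have hcl : ∀ i j : Fin m, i.val = 0 → j.val + 1 = m → G.Adj (e i) (e j) := by
    intro i j hi hj
    obtain rfl : j = l := Fin.ext (by omega)
    exact (hlast i j hi hj).resolve_right hwl
  obtain ⟨k, hk, hwk⟩ := hw
  have hkl : k.val + 1 ≠ m := by
    intro h
    obtain rfl : k = l := Fin.ext (by omega)
    exact hwl hwk
  by_cases hk1 : k.val = 1
  · -- inserting `w` between the first two vertices of the cycle: start the list at the second one
    left
    let s : Fin m → Fin m := fun i => if h : i.val + 1 < m then ⟨i + 1, h⟩ else ⟨0, by omega⟩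
    have hs : Function.Injective s := by
      intro i j h
      simp only [s] at h
      split_ifs at h <;> simp only [Fin.mk.injEq] at h <;> ext <;> omega
    refine ListsAllBut.cycleGraph_isSpanningSubgraphOf (e := e ∘ s) (w := w) (by omega)
      ⟨he.injective.comp hs, fun i => he.ne _, fun x => (he.cover x).imp_right ?_⟩ ?_ ?_ ?_
    · rintro ⟨i, rfl⟩
      obtain ⟨j, rfl⟩ := (Finite.injective_iff_surjective.1 hs) i
      exact ⟨j, rfl⟩
    · intro i j hij
      simp only [Function.comp, s]
      rw [dif_pos (by omega)]
      split_ifs with h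
      · exact hpath' _ _ (by dsimp only; omega)
      · exact (hcl _ _ rfl (by dsimp only; omega)).symm
    · intro i hi
      simp only [Function.comp, s]
      rw [dif_pos (by omega)]
      have : k = ⟨i.val + 1, by omega⟩ := Fin.ext (by dsimp only; omega)
      rwa [← this]
    · intro i hi
      simp only [Function.comp, s]
      rw [dif_neg (by omega)]
      exact h0 _ rfl
  · refine Or.inr ⟨k, by omega, by omega, he.cycleWithEar_isSpanningSubgraphOf
      (cycleGraph_hom (by omega) e hpath' hcl) ?_⟩
    rintro i (hi | hi)
    · exact h0 i hi
    · rwa [Fin.ext hi]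

lemma cycleGraph_adj_add_right {n : ℕ} [NeZero n] {i j t : Fin n} :
    (cycleGraph n).Adj (i + t) (j + t) ↔ (cycleGraph n).Adj i j := by
  rw [cycleGraph_adj', cycleGraph_adj', add_sub_add_right_eq_sub, add_sub_add_right_eq_sub]

/-- A spanning cycle may be listed from any given vertex. -/
lemma IsSpanningSubgraphOf.exists_cycleGraph_rotation {n : ℕ} {G : SimpleGraph V}
    (h : (cycleGraph n).IsSpanningSubgraphOf G) (v : V) :
    ∃ e : Fin n ≃ V, (∀ i j, (cycleGraph n).Adj i j → G.Adj (e i) (e j)) ∧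
      ∀ i : Fin n, i.val = 0 → e i = v := by
  obtain ⟨e, he⟩ := h
  have : NeZero n := ⟨by rintro rfl; exact (e.symm v).elim0⟩
  refine ⟨(Equiv.addRight (e.symm v)).trans e,
    fun i j hij => he _ _ (cycleGraph_adj_add_right.2 hij), fun i hi => ?_⟩
  have : i = 0 := Fin.ext hi
  simp [this]

/-- If contracting an edge of a 2-connected graph leaves a Hamiltonian graph, then the graph is
Hamiltonian, or the cycle misses just one vertex, which is an ear over it. -/
theorem IsTwoConnected.cycle_or_ear_of_contractInto [Fintype V] {G : SimpleGraph V}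
    (hG : G.IsTwoConnected) {u w : V} (huw : G.Adj u w) {m : ℕ} (hm : 3 ≤ m)
    (h : (cycleGraph m).IsSpanningSubgraphOf (G.contractInto u w)) :
    (cycleGraph (m + 1)).IsSpanningSubgraphOf G ∨
      ∃ k, 2 ≤ k ∧ k + 2 ≤ m ∧ (cycleWithEar m k).IsSpanningSubgraphOf G := by
  classical
  obtain ⟨g, hg, hg0⟩ := h.exists_cycleGraph_rotation ⟨u, huw.ne⟩
  let e : Fin m → V := fun i => g i
  have he0 : ∀ i : Fin m, i.val = 0 → e i = u := fun i hi => by simp [e, hg0 i hi]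
  have hinj : Function.Injective e := Subtype.val_injective.comp g.injective
  have heu : ∀ i : Fin m, i.val ≠ 0 → e i ≠ u := by
    intro i hi h
    have := hinj (h.trans (he0 ⟨0, by omega⟩ rfl).symm)
    exact hi (by rw [this])
  have he : ListsAllBut e w := by
    refine ⟨hinj, fun i => (g i).2, fun x => ?_⟩
    by_cases hx : x = w
    · exact Or.inl hx
    · exact Or.inr ⟨g.symm ⟨x, hx⟩, by simp [e]⟩
  have hpath : ∀ i j : Fin m, i.val ≠ 0 → i.val + 1 = j.val → G.Adj (e i) (e j) := by
    intro i j hi hij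
    have h := (contractInto_adj.1 (hg i j ((cycleGraph_adj_iff_val (by omega)).2 (Or.inl hij)))).2
    rcases h with h | ⟨h, -⟩ | ⟨h, -⟩
    · exact h
    · exact absurd h (heu i hi)
    · exact absurd h (heu j (by omega))
  have hend : ∀ i j : Fin m, i.val = 0 → j.val = 1 ∨ j.val + 1 = m →
      G.Adj u (e j) ∨ G.Adj w (e j) := by
    intro i j hi hj
    have hadj : (cycleGraph m).Adj i j := (cycleGraph_adj_iff_val (by omega)).2 (by omega)
    rcases (contractInto_adj.1 (hg i j hadj)).2 with h | ⟨-, h⟩ | ⟨h, -⟩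
    · exact Or.inl (by rw [← he0 i hi]; exact h)
    · exact Or.inr h
    · exact absurd h (heu j (by omega))
  rcases hend ⟨0, by omega⟩ ⟨1, by omega⟩ rfl (Or.inl rfl) with h1 | h1
  · refine he.cycle_or_ear hm hpath (fun i hi => by rw [he0 i hi]; exact huw.symm) ?_ ?_ ?_
    · intro i j hi hj
      rw [he0 i hi, show j = ⟨1, by omega⟩ from Fin.ext hj]; exact h1
    · intro i j hi hj
      rw [he0 i hi]
      exact hend i j hi (Or.inr hj)
    · obtain ⟨x, hx, hxu⟩ := hG.exists_adj_ne huw.ne'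
      obtain ⟨i, rfl⟩ := (he.cover x).resolve_left hx.ne'
      exact ⟨i, fun hi => hxu (he0 i hi), hx⟩
  · -- the same with the roles of `u` and `w` exchanged
    let e' : Fin m → V := fun i => if i.val = 0 then w else e i
    have he'0 : ∀ i : Fin m, i.val = 0 → e' i = w := fun i hi => by simp [e', hi]
    have he' : ∀ i : Fin m, i.val ≠ 0 → e' i = e i := fun i hi => by simp [e', hi]
    have hlist : ListsAllBut e' u := by
      refine ⟨fun i j h => ?_, fun i => ?_, fun x => ?_⟩
      · simp only [e'] at h
        split_ifs at h with hi hj hj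
        · exact Fin.ext (hi.trans hj.symm)
        · exact absurd h.symm (he.ne j)
        · exact absurd h (he.ne i)
        · exact hinj h
      · by_cases hi : i.val = 0
        · rw [he'0 i hi]; exact huw.ne'
        · rw [he' i hi]; exact heu i hi
      · rcases he.cover x with rfl | ⟨i, rfl⟩
        · exact Or.inr ⟨⟨0, by omega⟩, he'0 _ rfl⟩
        · by_cases hi : i.val = 0
          · exact Or.inl (he0 i hi)
          · exact Or.inr ⟨i, he' i hi⟩
    refine hlist.cycle_or_ear hm ?_ (fun i hi => by rw [he'0 i hi]; exact huw) ?_ ?_ ?_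
    · intro i j hi hij
      rw [he' i hi, he' j (by omega)]
      exact hpath i j hi hij
    · intro i j hi hj
      rw [he'0 i hi, he' j (by omega), show j = ⟨1, by omega⟩ from Fin.ext hj]; exact h1
    · intro i j hi hj
      rw [he'0 i hi, he' j (by omega)]
      exact (hend i j hi (Or.inr hj)).symm
    · obtain ⟨x, hx, hxw⟩ := hG.exists_adj_ne huw.ne
      obtain ⟨i, rfl⟩ := (hlist.cover x).resolve_left hx.ne'
      exact ⟨i, fun hi => hxw (he'0 i hi), hx⟩

/-! ### Small 2-connected graphs -/

lemma IsTwoConnected.cycleGraph_three [Fintype V] {G : SimpleGraph V} (hG : G.IsTwoConnected)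
    (hV : Fintype.card V = 3) : (cycleGraph 3).IsSpanningSubgraphOf G := by
  let e : Fin 3 ≃ V := (Fintype.equivFinOfCardEq hV).symm
  refine ⟨e, fun i j hij => ?_⟩
  obtain ⟨k, hki, hkj⟩ : ∃ k : Fin 3, k ≠ i ∧ k ≠ j := by
    have := hij.ne
    revert i j
    decide
  obtain ⟨x, hx, hxk⟩ := hG.exists_adj_ne (e.injective.ne hki.symm)
  obtain ⟨l, rfl⟩ := e.surjective x
  have hli : l ≠ i := fun h => hx.ne (by rw [h])
  have hlk : l ≠ k := fun h => hxk (by rw [h])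
  have hij := hij.ne
  obtain rfl : l = j := by omega
  exact hx

lemma IsTwoConnected.exists_contractInto [Fintype V] {G : SimpleGraph V} (hG : G.IsTwoConnected)
    {m : ℕ} (hV : Fintype.card V = m + 1) (hm : 3 ≤ m) :
    ∃ (u w : V) (_ : Fintype {x : V // x ≠ w}), G.Adj u w ∧ (G.contractInto u w).IsTwoConnected ∧
      Fintype.card {x : V // x ≠ w} = m := by
  classical
  obtain ⟨u⟩ := hG.connected.nonempty
  obtain ⟨w, huw, hconn⟩ := hG.exists_adj_connected_induce u
  refine ⟨u, w, inferInstance, huw, hG.contractInto (by omega) huw hconn, ?_⟩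
  rw [Fintype.card_subtype_compl, Fintype.card_subtype_eq]
  omega

lemma IsTwoConnected.cycleGraph_four [Fintype V] {G : SimpleGraph V} (hG : G.IsTwoConnected)
    (hV : Fintype.card V = 4) : (cycleGraph 4).IsSpanningSubgraphOf G := by
  obtain ⟨u, w, _, huw, hc, hcard⟩ := hG.exists_contractInto hV le_rfl
  rcases hG.cycle_or_ear_of_contractInto huw le_rfl (hc.cycleGraph_three hcard) with
    h | ⟨k, h1, h2, -⟩
  · exact h
  · omega

/-- The second alternative is `K_{2,3}`, a four-cycle with an ear between opposite vertices. -/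
lemma IsTwoConnected.cycle_or_ear_five [Fintype V] {G : SimpleGraph V} (hG : G.IsTwoConnected)
    (hV : Fintype.card V = 5) :
    (cycleGraph 5).IsSpanningSubgraphOf G ∨ (cycleWithEar 4 2).IsSpanningSubgraphOf G := by
  obtain ⟨u, w, _, huw, hc, hcard⟩ := hG.exists_contractInto hV (by norm_num)
  rcases hG.cycle_or_ear_of_contractInto huw (by norm_num) (hc.cycleGraph_four hcard) with
    h | ⟨k, h1, h2, h⟩
  · exact Or.inl h
  · obtain rfl : k = 2 := by omega
    exact Or.inr h

/-- Every 2-connected graph on `n ≥ 4` vertices contracts to one on four vertices, which contains a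
four-cycle. -/
theorem IsTwoConnected.rainbowConnectsTriples {n : ℕ} (hn : 4 ≤ n) :
    ∀ {V : Type*} [Fintype V] {G : SimpleGraph V}, G.IsTwoConnected → Fintype.card V = n →
      G.RainbowConnectsTriples (n - 2) := by
  induction n, hn using Nat.le_induction with
  | base =>
    intro V _ G hG hV
    exact rainbowConnectsTriples_cycleGraph_four.of_isSpanningSubgraphOf (hG.cycleGraph_four hV)
  | succ m hm ih =>
    intro V _ G hG hV
    obtain ⟨u, w, _, huw, hc, hcard⟩ := hG.exists_contractInto hV (by omega)
    have := RainbowConnectsTriples.of_contractInto huw (ih hc hcard)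
    rwa [show m - 2 + 1 = m + 1 - 2 by omega] at this

/-! ### Splitting a vertex of `K_{2,3}` -/

lemma bijective_of_nodup_ofFn [Fintype V] {n : ℕ} (hV : Fintype.card V = n) (φ : Fin n → V)
    (h : (List.ofFn φ).Nodup) : Function.Bijective φ :=
  (Fintype.bijective_iff_injective_and_card φ).2 ⟨List.nodup_ofFn.1 h, by simp [hV]⟩

lemma cycleGraph_six_of_nodup [Fintype V] (hV : Fintype.card V = 6) {G : SimpleGraph V}
    {x₀ x₁ x₂ x₃ x₄ x₅ : V} (h : [x₀, x₁, x₂, x₃, x₄, x₅].Nodup) (h₀ : G.Adj x₀ x₁)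
    (h₁ : G.Adj x₁ x₂) (h₂ : G.Adj x₂ x₃) (h₃ : G.Adj x₃ x₄) (h₄ : G.Adj x₄ x₅)
    (h₅ : G.Adj x₀ x₅) : (cycleGraph 6).IsSpanningSubgraphOf G := by
  let φ : Fin 6 → V := ![x₀, x₁, x₂, x₃, x₄, x₅]
  have hφ : Function.Bijective φ :=
    bijective_of_nodup_ofFn hV φ (by simpa [φ, List.ofFn_succ] using h)
  refine ⟨Equiv.ofBijective φ hφ, cycleGraph_hom (by norm_num) φ ?_ ?_⟩
  · intro i j hij
    fin_cases i <;> fin_cases j <;> first | (exfalso; simp at hij; done) | assumption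
  · intro i j hi hj
    fin_cases i <;> fin_cases j <;> first | (exfalso; simp at hi hj; done) | assumption

/-- A five-cycle `x₀ x₁ x₂ x₃ x₄` with an ear `x₀ y x₂`. -/
lemma rainbowConnectsTriples_three_of_ear [Fintype V] (hV : Fintype.card V = 6)
    {G : SimpleGraph V} {x₀ x₁ x₂ x₃ x₄ y : V} (h : [x₀, x₁, x₂, x₃, x₄, y].Nodup)
    (h₀ : G.Adj x₀ x₁) (h₁ : G.Adj x₁ x₂) (h₂ : G.Adj x₂ x₃) (h₃ : G.Adj x₃ x₄) (h₄ : G.Adj x₀ x₄)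
    (hy₀ : G.Adj y x₀) (hy₂ : G.Adj y x₂) : G.RainbowConnectsTriples 3 := by
  refine (rainbowConnectsTriples_cycleWithEar (m := 5) le_rfl le_rfl (by norm_num)
    ).of_isSpanningSubgraphOf
    (ListsAllBut.cycleWithEar_isSpanningSubgraphOf (e := ![x₀, x₁, x₂, x₃, x₄]) (w := y) ?_ ?_ ?_)
  · have hφ : Function.Bijective ![x₀, x₁, x₂, x₃, x₄, y] :=
      bijective_of_nodup_ofFn hV _ (by simpa [List.ofFn_succ] using h)
    refine ⟨List.nodup_ofFn.1 ?_, ?_, fun z => ?_⟩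
    · simp only [List.nodup_cons, List.mem_cons] at h
      simp [List.ofFn_succ]
      grind
    · simp only [List.nodup_cons, List.mem_cons] at h
      intro i
      fin_cases i <;> simp <;> grind
    · obtain ⟨i, rfl⟩ := hφ.2 z
      fin_cases i
      · exact Or.inr ⟨0, rfl⟩
      · exact Or.inr ⟨1, rfl⟩
      · exact Or.inr ⟨2, rfl⟩
      · exact Or.inr ⟨3, rfl⟩
      · exact Or.inr ⟨4, rfl⟩
      · exact Or.inl rfl
  · refine cycleGraph_hom (by norm_num) _ ?_ ?_
    · intro i j hij
      fin_cases i <;> fin_cases j <;> first | (exfalso; simp at hij; done) | assumption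
    · intro i j hi hj
      fin_cases i <;> fin_cases j <;> first | (exfalso; simp at hi hj; done) | assumption
  · intro i hi
    fin_cases i <;> first | (exfalso; simp at hi; done) | assumption

lemma rainbowConnectsTriples_three_of_two_by_four [Fintype V] (hV : Fintype.card V = 6)
    {G : SimpleGraph V} {p q a b c d : V} (h : [p, q, a, b, c, d].Nodup) (hpa : G.Adj p a)
    (hpb : G.Adj p b) (hpc : G.Adj p c) (hpd : G.Adj p d) (hqa : G.Adj q a) (hqb : G.Adj q b)
    (hqc : G.Adj q c) (hqd : G.Adj q d) : G.RainbowConnectsTriples 3 := by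
  let φ : Fin 6 → V := ![p, q, a, b, c, d]
  have hφ : Function.Bijective φ :=
    bijective_of_nodup_ofFn hV φ (by simpa [φ, List.ofFn_succ] using h)
  refine (rainbowConnectsTriples_of_two_by_four (G := G.comap φ) ?_ ?_).of_isSpanningSubgraphOf
    ⟨Equiv.ofBijective φ hφ, fun _ _ h => h⟩ <;>
  · intro i hi
    fin_cases i <;> first | (exfalso; simp at hi; done) | assumption

/-- Splitting a vertex of degree three in `K_{2,3}`: here `q` is the other such vertex, and `a`,
`b`, `c` are the vertices of degree two. -/
lemma rainbowConnectsTriples_of_split_degree_three [Fintype V] (hV : Fintype.card V = 6)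
    {G : SimpleGraph V} {u w q a b c : V} (hnd : [u, w, q, a, b, c].Nodup) (huw : G.Adj u w)
    (hqa : G.Adj q a) (hqb : G.Adj q b) (hqc : G.Adj q c) (ha : G.Adj u a ∨ G.Adj w a)
    (hb : G.Adj u b ∨ G.Adj w b) (hc : G.Adj u c ∨ G.Adj w c)
    (hu : G.Adj u q ∨ G.Adj u a ∨ G.Adj u b ∨ G.Adj u c)
    (hw : G.Adj w q ∨ G.Adj w a ∨ G.Adj w b ∨ G.Adj w c) : G.RainbowConnectsTriples 3 := by
  -- if both ends of the split edge reach `{a, b, c}`, three paths lead from one of them to `q`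
  have core : ∀ u w a b c : V, [u, w, q, a, b, c].Nodup → G.Adj u w → G.Adj q a → G.Adj q b →
      G.Adj q c → G.Adj u a → G.Adj w b → G.Adj u c → G.RainbowConnectsTriples 3 := by
    intro u w a b c hnd huw hqa hqb hqc hua hwb huc
    refine rainbowConnectsTriples_three_of_ear hV (x₀ := u) (x₁ := a) (x₂ := q) (x₃ := b) (x₄ := w)
      (y := c) ?_ hua hqa.symm hqb hwb.symm huw huc.symm hqc.symm
    simp only [List.nodup_cons, List.mem_cons] at hnd ⊢
    grind
  have core' : ∀ u w a b c : V, [u, w, q, a, b, c].Nodup → G.Adj u w → G.Adj q a → G.Adj q b →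
      G.Adj q c → G.Adj u a → G.Adj w b → (G.Adj u c ∨ G.Adj w c) →
      G.RainbowConnectsTriples 3 := by
    intro u w a b c hnd huw hqa hqb hqc hua hwb hc
    rcases hc with huc | hwc
    · exact core u w a b c hnd huw hqa hqb hqc hua hwb huc
    · refine core w u b a c ?_ huw.symm hqb hqa hqc hwb hua hwc
      simp only [List.nodup_cons, List.mem_cons] at hnd ⊢
      grind
  -- otherwise all of `a`, `b`, `c` hang on `u`, and `w` can only be joined to `q`
  have all_u : ∀ u w : V, [u, w, q, a, b, c].Nodup → G.Adj u w → G.Adj u a → G.Adj u b → G.Adj u c →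
      (G.Adj w q ∨ G.Adj w a ∨ G.Adj w b ∨ G.Adj w c) → G.RainbowConnectsTriples 3 := by
    intro u w hnd huw hua hub huc hw
    rcases hw with hw | hw | hw | hw
    · refine rainbowConnectsTriples_three_of_two_by_four hV (p := u) (q := q) (a := w) (b := a)
        (c := b) (d := c) ?_ huw hua hub huc hw.symm hqa hqb hqc
      simp only [List.nodup_cons, List.mem_cons] at hnd ⊢
      grind
    · refine core u w b a c ?_ huw hqb hqa hqc hub hw huc
      simp only [List.nodup_cons, List.mem_cons] at hnd ⊢
      grind
    · exact core u w a b c hnd huw hqa hqb hqc hua hw huc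
    · refine core u w a c b ?_ huw hqa hqc hqb hua hw hub
      simp only [List.nodup_cons, List.mem_cons] at hnd ⊢
      grind
  have hnd' : [w, u, q, a, b, c].Nodup := by
    simp only [List.nodup_cons, List.mem_cons] at hnd ⊢
    grind
  have hnd₁ : [u, w, q, a, c, b].Nodup ∧ [w, u, q, a, c, b].Nodup := by
    simp only [List.nodup_cons, List.mem_cons] at hnd ⊢
    grind
  rcases ha with ha | ha <;> rcases hb with hb | hb
  · rcases hc with hc | hc
    · exact all_u u w hnd huw ha hb hc hw
    · exact core' u w a c b hnd₁.1 huw hqa hqc hqb ha hc (Or.inl hb)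
  · exact core' u w a b c hnd huw hqa hqb hqc ha hb hc
  · exact core' w u a b c hnd' huw.symm hqa hqb hqc ha hb hc.symm
  · rcases hc with hc | hc
    · exact core' w u a c b hnd₁.2 huw.symm hqa hqc hqb ha hc (Or.inl hb)
    · exact all_u w u hnd' huw.symm ha hb hc hu

/-- Splitting a vertex of degree two in `K_{2,3}`: here `p`, `q` are the vertices of degree three,
and `b`, `c` are the other vertices of degree two. -/
lemma cycleGraph_or_rainbowConnectsTriples_of_split_degree_two [Fintype V]
    (hV : Fintype.card V = 6) {G : SimpleGraph V} {u w p q b c : V}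
    (hnd : [u, w, p, q, b, c].Nodup) (huw : G.Adj u w) (hpb : G.Adj p b) (hpc : G.Adj p c)
    (hqb : G.Adj q b) (hqc : G.Adj q c) (hp : G.Adj u p ∨ G.Adj w p) (hq : G.Adj u q ∨ G.Adj w q)
    (hu : G.Adj u p ∨ G.Adj u q ∨ G.Adj u b ∨ G.Adj u c)
    (hw : G.Adj w p ∨ G.Adj w q ∨ G.Adj w b ∨ G.Adj w c) :
    (cycleGraph 6).IsSpanningSubgraphOf G ∨ G.RainbowConnectsTriples 3 := by
  have core : ∀ u w : V, [u, w, p, q, b, c].Nodup → G.Adj u w → G.Adj u p → G.Adj w q →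
      G.RainbowConnectsTriples 3 := by
    intro u w hnd huw hup hwq
    refine rainbowConnectsTriples_three_of_ear hV (x₀ := p) (x₁ := b) (x₂ := q) (x₃ := w) (x₄ := u)
      (y := c) ?_ hpb hqb.symm hwq.symm huw.symm hup.symm hpc.symm hqc.symm
    simp only [List.nodup_cons, List.mem_cons] at hnd ⊢
    grind
  have hnd' : [w, u, p, q, b, c].Nodup := by
    simp only [List.nodup_cons, List.mem_cons] at hnd ⊢
    grind
  have both_u : ∀ u w : V, [u, w, p, q, b, c].Nodup → [w, u, p, q, b, c].Nodup → G.Adj u w →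
      G.Adj u p → G.Adj u q → (G.Adj w p ∨ G.Adj w q ∨ G.Adj w b ∨ G.Adj w c) →
      (cycleGraph 6).IsSpanningSubgraphOf G ∨ G.RainbowConnectsTriples 3 := by
    intro u w hnd hnd' huw hup huq hw
    rcases hw with hw | hw | hw | hw
    · exact Or.inr (core w u hnd' huw.symm hw huq)
    · exact Or.inr (core u w hnd huw hup hw)
    · refine Or.inl (cycleGraph_six_of_nodup hV (x₀ := u) (x₁ := w) (x₂ := b) (x₃ := q) (x₄ := c)
        (x₅ := p) ?_ huw hw hqb.symm hqc hpc.symm hup)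
      simp only [List.nodup_cons, List.mem_cons] at hnd ⊢
      grind
    · refine Or.inl (cycleGraph_six_of_nodup hV (x₀ := u) (x₁ := w) (x₂ := c) (x₃ := q) (x₄ := b)
        (x₅ := p) ?_ huw hw hqc.symm hqb hpb.symm hup)
      simp only [List.nodup_cons, List.mem_cons] at hnd ⊢
      grind
  rcases hp with hp | hp <;> rcases hq with hq | hq
  · exact both_u u w hnd hnd' huw hp hq hw
  · exact Or.inr (core u w hnd huw hp hq)
  · exact Or.inr (core w u hnd' huw.symm hp hq)
  · exact both_u w u hnd' hnd huw.symm hp hq hu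

/-- A 2-connected graph on six vertices that contracts to a graph containing `K_{2,3}`, written here
as a four-cycle with an ear between opposite vertices, is Hamiltonian or needs only three colors. -/
lemma IsTwoConnected.cycleGraph_or_rainbowConnectsTriples_of_contractInto [Fintype V]
    {G : SimpleGraph V} (hG : G.IsTwoConnected) (hV : Fintype.card V = 6) {u w : V}
    (huw : G.Adj u w) (h : (cycleWithEar 4 2).IsSpanningSubgraphOf (G.contractInto u w)) :
    (cycleGraph 6).IsSpanningSubgraphOf G ∨ G.RainbowConnectsTriples 3 := by
  obtain ⟨f, hf⟩ := h
  let F : Option (Fin 4) → V := fun x => f x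
  have hF : Function.Injective F := Subtype.val_injective.comp f.injective
  have hFw : ∀ x, w ≠ F x := fun x h => (f x).2 h.symm
  have hcov : ∀ x, x ≠ w → ∃ y, F y = x := fun x hx => ⟨f.symm ⟨x, hx⟩, by simp [F]⟩
  have hadj : ∀ x y, (cycleWithEar 4 2).Adj x y →
      G.Adj (F x) (F y) ∨ (F x = u ∧ G.Adj w (F y)) ∨ (F y = u ∧ G.Adj w (F x)) :=
    fun x y hxy => (contractInto_adj.1 (hf x y hxy)).2
  -- the parts of `K_{2,3}` are `{some 0, some 2}` and `{none, some 1, some 3}`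
  have h0n := hadj (some 0) none (cycleWithEar_adj_none (Or.inl rfl)).symm
  have h2n := hadj (some 2) none (cycleWithEar_adj_none (Or.inr rfl)).symm
  have h01 := hadj (some 0) (some 1) (cycleWithEar_adj_some (by simp [cycleGraph_adj_iff_val]))
  have h03 := hadj (some 0) (some 3) (cycleWithEar_adj_some (by simp [cycleGraph_adj_iff_val]))
  have h21 := hadj (some 2) (some 1) (cycleWithEar_adj_some (by simp [cycleGraph_adj_iff_val]))
  have h23 := hadj (some 2) (some 3) (cycleWithEar_adj_some (by simp [cycleGraph_adj_iff_val]))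
  have hexp : ∀ (P : V → Prop), (∃ x, P x ∧ x ≠ w) →
      P (F none) ∨ P (F (some 0)) ∨ P (F (some 1)) ∨ P (F (some 2)) ∨ P (F (some 3)) := by
    rintro P ⟨x, hx, hxw⟩
    obtain ⟨y, rfl⟩ := hcov x hxw
    rcases y with _ | y
    · exact Or.inl hx
    · fin_cases y <;> simp_all
  have hu := hexp _ (hG.exists_adj_ne huw.ne)
  obtain ⟨x, hx, hxu⟩ := hG.exists_adj_ne huw.ne'
  have hw := hexp (fun x => G.Adj w x ∧ x ≠ u) ⟨x, ⟨hx, hxu⟩, hx.ne'⟩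
  clear hx hxu
  obtain ⟨y, rfl⟩ := hcov u huw.ne
  have hnd : [F none, w, F (some 0), F (some 1), F (some 2), F (some 3)].Nodup := by
    simp [hF.eq_iff, hFw, (hFw _).symm]
  simp only [List.nodup_cons, List.mem_cons] at hnd
  have hcomm := G.adj_comm
  have hirr : ∀ v, ¬ G.Adj v v := fun _ => G.irrefl
  clear_value F
  clear hf hadj hexp hcov hFw hF f
  rcases y with _ | y
  · refine cycleGraph_or_rainbowConnectsTriples_of_split_degree_two hV (p := F (some 0))
      (q := F (some 2)) (b := F (some 1)) (c := F (some 3)) ?_ huw ?_ ?_ ?_ ?_ ?_ ?_ ?_ ?_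
    · simp only [List.nodup_cons, List.mem_cons]; grind
    all_goals grind
  fin_cases y
  · refine Or.inr (rainbowConnectsTriples_of_split_degree_three hV (q := F (some 2))
      (a := F none) (b := F (some 1)) (c := F (some 3)) ?_ huw ?_ ?_ ?_ ?_ ?_ ?_ ?_ ?_)
    · simp only [List.nodup_cons, List.mem_cons]; grind
    all_goals grind
  · refine cycleGraph_or_rainbowConnectsTriples_of_split_degree_two hV (p := F (some 0))
      (q := F (some 2)) (b := F none) (c := F (some 3)) ?_ huw ?_ ?_ ?_ ?_ ?_ ?_ ?_ ?_
    · simp only [List.nodup_cons, List.mem_cons]; grind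
    all_goals grind
  · refine Or.inr (rainbowConnectsTriples_of_split_degree_three hV (q := F (some 0))
      (a := F none) (b := F (some 1)) (c := F (some 3)) ?_ huw ?_ ?_ ?_ ?_ ?_ ?_ ?_ ?_)
    · simp only [List.nodup_cons, List.mem_cons]; grind
    all_goals grind
  · refine cycleGraph_or_rainbowConnectsTriples_of_split_degree_two hV (p := F (some 0))
      (q := F (some 2)) (b := F none) (c := F (some 1)) ?_ huw ?_ ?_ ?_ ?_ ?_ ?_ ?_ ?_
    · simp only [List.nodup_cons, List.mem_cons]; grind
    all_goals grind

/-! ### Graphs that need only `n - 3` colors -/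

/-- A 2-connected graph on `n ≥ 6` vertices without a Hamiltonian cycle can be colored with `n - 3`
colors. -/
theorem IsTwoConnected.cycleGraph_or_rainbowConnectsTriples {n : ℕ} (hn : 6 ≤ n) :
    ∀ {V : Type*} [Fintype V] {G : SimpleGraph V}, G.IsTwoConnected → Fintype.card V = n →
      (cycleGraph n).IsSpanningSubgraphOf G ∨ G.RainbowConnectsTriples (n - 3) := by
  have ear : ∀ {V : Type _} [Fintype V] {G : SimpleGraph V} {u w : V} {m : ℕ}, 5 ≤ m →
      G.IsTwoConnected → G.Adj u w → (cycleGraph m).IsSpanningSubgraphOf (G.contractInto u w) →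
      (cycleGraph (m + 1)).IsSpanningSubgraphOf G ∨ G.RainbowConnectsTriples (m - 2) := by
    intro V _ G u w m hm hG huw h
    rcases hG.cycle_or_ear_of_contractInto huw (by omega) h with h | ⟨k, hk, hkm, h⟩
    · exact Or.inl h
    · exact Or.inr ((rainbowConnectsTriples_cycleWithEar hm hk hkm).of_isSpanningSubgraphOf h)
  induction n, hn using Nat.le_induction with
  | base =>
    intro V _ G hG hV
    obtain ⟨u, w, _, huw, hc, hcard⟩ := hG.exists_contractInto hV (by norm_num)
    rcases hc.cycle_or_ear_five hcard with h | h
    · exact ear le_rfl hG huw h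
    · exact hG.cycleGraph_or_rainbowConnectsTriples_of_contractInto hV huw h
  | succ m hm ih =>
    intro V _ G hG hV
    obtain ⟨u, w, _, huw, hc, hcard⟩ := hG.exists_contractInto hV (by omega)
    rcases ih hc hcard with h | h
    · exact ear (by omega) hG huw h
    · have := RainbowConnectsTriples.of_contractInto huw h
      rw [show m - 3 + 1 = m + 1 - 3 by omega] at this
      exact Or.inr this

/-- For `n ≥ 7`, any chord of a Hamiltonian cycle saves a color. -/
lemma cycleGraph_iso_or_rainbowConnectsTriples {n : ℕ} (hn : 7 ≤ n) {G : SimpleGraph V}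
    (h : (cycleGraph n).IsSpanningSubgraphOf G) :
    Nonempty (G ≃g cycleGraph n) ∨ G.RainbowConnectsTriples (n - 3) := by
  obtain ⟨e, he⟩ := h
  have : NeZero n := ⟨by omega⟩
  by_cases hch : ∀ i j, G.Adj (e i) (e j) → (cycleGraph n).Adj i j
  · refine Or.inl ⟨⟨e.symm, fun {x y} => ⟨fun hxy => ?_, fun hxy => hch _ _ (by simpa using hxy)⟩⟩⟩
    simpa using he _ _ hxy
  · right
    push Not at hch
    obtain ⟨i, j, hij, hnc⟩ := hch
    -- rotate the cycle so that the chord starts at `0`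
    obtain ⟨d, rfl⟩ : ∃ d, j = d + i := ⟨j - i, by simp⟩
    have hk : ¬ (cycleGraph n).Adj 0 d := by
      rw [← cycleGraph_adj_add_right (t := i)]
      simpa using hnc
    rw [cycleGraph_adj_iff_val (by omega)] at hk
    have hk0 : d.val ≠ 0 := by
      intro h
      obtain rfl : d = 0 := Fin.ext h
      simp at hij
    simp only [Fin.val_zero, true_and, not_or] at hk
    refine (rainbowConnectsTriples_cycleWithChord hn (k := d) (by omega) (by omega)
      ).of_isSpanningSubgraphOf ⟨(Equiv.addRight i).trans e, cycleWithChord_hom _ ?_ ?_⟩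
    · exact fun a b hab => he _ _ (cycleGraph_adj_add_right.2 hab)
    · intro a b ha hb _
      obtain rfl : a = 0 := Fin.ext ha
      obtain rfl : b = d := Fin.ext hb
      simpa using hij

lemma threeSun_adj_iff {i j : Fin 6} : threeSun.Adj i j ↔
    (cycleGraph 6).Adj i j ∨ (i ≠ j ∧ i.val % 2 = 1 ∧ j.val % 2 = 1) := by
  rw [threeSun, sup_adj]
  refine or_congr_right ?_
  rw [fromEdgeSet_adj, and_comm]
  refine and_congr_right fun _ => ?_
  fin_cases i <;> fin_cases j <;> simp_all

/-- A graph on six vertices with a Hamiltonian cycle either lies in the 3-sun or has, up to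
rotation, a long chord, two crossing short chords or two parallel short chords. -/
lemma isSpanningSubgraphOf_threeSun_or_rainbowConnectsTriples {G : SimpleGraph V}
    (h : (cycleGraph 6).IsSpanningSubgraphOf G) :
    G.IsSpanningSubgraphOf threeSun ∨ G.RainbowConnectsTriples 3 := by
  obtain ⟨e, he⟩ := h
  by_cases hG : G.RainbowConnectsTriples 3
  · exact Or.inr hG
  left
  have hrot : ∀ t : Fin 6, ¬ (G.comap fun i => e (i + t)).RainbowConnectsTriples 3 := fun t ht =>
    hG (ht.of_isSpanningSubgraphOf ⟨(Equiv.addRight t).trans e, fun _ _ h => h⟩)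
  have hcyc : ∀ t : Fin 6, cycleGraph 6 ≤ G.comap fun i => e (i + t) := fun t a b hab =>
    he _ _ (cycleGraph_adj_add_right.2 hab)
  have hlong : ∀ t, ¬ G.Adj (e t) (e (3 + t)) := by
    intro t ht
    refine hrot t (rainbowConnectsTriples_cycleWithChord_six_three.of_isSpanningSubgraphOf
      ⟨Equiv.refl _, cycleWithChord_hom _ (hcyc t) ?_⟩)
    intro a b ha hb _
    obtain rfl : a = 0 := Fin.ext ha
    obtain rfl : b = 3 := Fin.ext hb
    simpa using ht
  have hcross : ∀ t, G.Adj (e t) (e (2 + t)) → ¬ G.Adj (e (1 + t)) (e (3 + t)) := fun t h₁ h₂ =>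
    hrot t (rainbowConnectsTriples_of_crossing_chords (hcyc t) (by simpa using h₁) h₂)
  have hpar : ∀ t, G.Adj (e t) (e (2 + t)) → ¬ G.Adj (e (3 + t)) (e (5 + t)) := fun t h₁ h₂ =>
    hrot t (rainbowConnectsTriples_of_parallel_chords (hcyc t) (by simpa using h₁) h₂)
  -- hence all chords join vertices of the same parity
  have hcomm := G.adj_comm
  have hirr : ∀ v, ¬ G.Adj v v := fun _ => G.irrefl
  have l0 := hlong 0
  have l1 := hlong 1
  have l2 := hlong 2
  have c0 := hcross 0
  have c1 := hcross 1
  have c2 := hcross 2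
  have c3 := hcross 3
  have c4 := hcross 4
  have c5 := hcross 5
  have p0 := hpar 0
  have p1 := hpar 1
  have p2 := hpar 2
  norm_num [Fin.reduceAdd] at l0 l1 l2 c0 c1 c2 c3 c4 c5 p0 p1 p2
  by_cases hodd : G.Adj (e 1) (e 3) ∨ G.Adj (e 3) (e 5) ∨ G.Adj (e 5) (e 1)
  · have h02 : ¬ G.Adj (e 0) (e 2) ∧ ¬ G.Adj (e 2) (e 4) ∧ ¬ G.Adj (e 4) (e 0) := by grind
    refine ⟨e.symm, fun u v huv => ?_⟩
    obtain ⟨i, rfl⟩ := e.surjective u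
    obtain ⟨j, rfl⟩ := e.surjective v
    rw [Equiv.symm_apply_apply, Equiv.symm_apply_apply, threeSun_adj_iff,
      cycleGraph_adj_iff_val (by norm_num)]
    clear hlong hcross hpar hrot hcyc he
    fin_cases i <;> fin_cases j <;> first | (simp; done) | (exfalso; simp at huv <;> grind)
  · refine ⟨e.symm.trans (Equiv.addRight 1), fun u v huv => ?_⟩
    obtain ⟨i, rfl⟩ := e.surjective u
    obtain ⟨j, rfl⟩ := e.surjective v
    rw [threeSun_adj_iff, cycleGraph_adj_iff_val (by norm_num)]
    simp only [Equiv.trans_apply, Equiv.symm_apply_apply, Equiv.coe_addRight]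
    clear hlong hcross hpar hrot hcyc he
    fin_cases i <;> fin_cases j <;> first | (simp; done) | (exfalso; simp at huv <;> grind)

lemma isSpanningSubgraphOf_completeFiveMinusEdge_or_eq_top [Fintype V] (hV : Fintype.card V = 5)
    (G : SimpleGraph V) : G.IsSpanningSubgraphOf completeFiveMinusEdge ∨ G = ⊤ := by
  by_cases hG : G = ⊤
  · exact Or.inr hG
  left
  obtain ⟨a, b, hne, hab⟩ := ne_top_iff_exists_not_adj.1 hG
  let e := Fintype.equivFinOfCardEq hV
  let e₁ := e.trans (Equiv.swap (e a) 0)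
  let e₂ := e₁.trans (Equiv.swap (e₁ b) 1)
  have ha₁ : e₁ a = 0 := by simp [e₁]
  have hb : e₂ b = 1 := by simp [e₂]
  have ha : e₂ a = 0 := by
    have h : e₁ b ≠ 0 := fun h => hne (e₁.injective (ha₁.trans h.symm))
    simp only [e₂, Equiv.trans_apply, ha₁]
    exact Equiv.swap_apply_of_ne_of_ne h.symm (by simp)
  refine ⟨e₂, fun u v huv => ?_⟩
  rw [completeFiveMinusEdge, deleteEdges_adj]
  refine ⟨e₂.injective.ne huv.ne, fun h => ?_⟩
  simp only [Set.mem_singleton_iff, Sym2.eq_iff, ← ha, ← hb, e₂.injective.eq_iff] at h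
  rcases h with ⟨rfl, rfl⟩ | ⟨rfl, rfl⟩
  · exact hab huv
  · exact hab huv.symm

lemma rainbowConnectsTriples_top [Fintype V] (hV : Fintype.card V = 5) :
    (⊤ : SimpleGraph V).RainbowConnectsTriples 2 :=
  rainbowConnectsTriples_top_five.of_isSpanningSubgraphOf
    ⟨(Fintype.equivFinOfCardEq hV).symm, fun _ _ h => (Equiv.injective _).ne h⟩

/-! ### Lower bounds -/

lemma Reachable.mem_of_closed {H : SimpleGraph V} {x y : V} (h : H.Reachable x y) {A : Set V}
    (hA : ∀ a b, H.Adj a b → a ∈ A → b ∈ A) (hx : x ∈ A) : y ∈ A := by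
  obtain ⟨w⟩ := h
  induction w with
  | nil => exact hx
  | cons hadj _ ih => exact ih (hA _ _ hadj hx)

lemma Reachable.exists_mem_of_ne {F : Set (Sym2 V)} {x y : V} (h : (fromEdgeSet F).Reachable x y)
    (hxy : x ≠ y) : ∃ a, s(x, a) ∈ F ∧ x ≠ a := by
  obtain ⟨w⟩ := h
  cases w with
  | nil => exact absurd rfl hxy
  | cons hadj _ => exact ⟨_, (fromEdgeSet_adj _).1 hadj⟩

/-- Two colors can only connect three vertices by a path on exactly these vertices. -/
lemma mem_of_two_colors {F : Set (Sym2 V)} {c : Sym2 V → ℕ} (hlt : ∀ e ∈ F, c e < 2)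
    (hinj : Set.InjOn c F) {x y z : V} (hxy : x ≠ y) (hxz : x ≠ z) (hyz : y ≠ z)
    (hy : (fromEdgeSet F).Reachable x y) (hz : (fromEdgeSet F).Reachable x z) :
    (s(x, y) ∈ F ∧ s(x, z) ∈ F) ∨ (s(x, y) ∈ F ∧ s(y, z) ∈ F) ∨ (s(x, z) ∈ F ∧ s(y, z) ∈ F) := by
  -- an edge `xy` in `F` leaves one more edge, which has to attach `z`
  have key : ∀ x y z : V, x ≠ y → x ≠ z → y ≠ z → (fromEdgeSet F).Reachable x z → s(x, y) ∈ F →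
      s(x, z) ∈ F ∨ s(y, z) ∈ F := by
    intro x y z hxy hxz hyz hz hF
    obtain ⟨d, hd, hzd⟩ := hz.symm.exists_mem_of_ne hxz.symm
    by_cases hdx : d = x
    · subst hdx; rw [Sym2.eq_swap]; exact Or.inl hd
    by_cases hdy : d = y
    · subst hdy; rw [Sym2.eq_swap (a := d)]; exact Or.inr hd
    exfalso
    have hall : ∀ e ∈ F, e = s(x, y) ∨ e = s(z, d) := by
      intro e he
      have hne : c s(x, y) ≠ c s(z, d) := fun h => by
        have := hinj hF hd h
        simp only [Sym2.eq_iff] at this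
        grind
      have h1 := hlt _ hF
      have h2 := hlt _ hd
      have h3 := hlt _ he
      rcases (by omega : c e = c s(x, y) ∨ c e = c s(z, d)) with h | h
      · exact Or.inl (hinj he hF h)
      · exact Or.inr (hinj he hd h)
    have := hz.mem_of_closed (A := {x, y}) (fun a b hab ha => by
      rcases hall _ ((fromEdgeSet_adj _).1 hab).1 with h | h <;>
      simp only [Sym2.eq_iff, Set.mem_insert_iff, Set.mem_singleton_iff] at h ha ⊢ <;> grind)
      (by simp)
    simp only [Set.mem_insert_iff, Set.mem_singleton_iff] at this
    grind
  obtain ⟨a, ha, hxa⟩ := hy.exists_mem_of_ne hxy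
  obtain ⟨b, hb, hyb⟩ := hy.symm.exists_mem_of_ne hxy.symm
  obtain ⟨d, hd, hzd⟩ := hz.symm.exists_mem_of_ne hxz.symm
  have h1 := hlt _ ha
  have h2 := hlt _ hb
  have h3 := hlt _ hd
  rcases (by omega : c s(x, a) = c s(y, b) ∨ c s(x, a) = c s(z, d) ∨ c s(y, b) = c s(z, d)) with
    h | h | h
  · have h := hinj ha hb h
    simp only [Sym2.eq_iff] at h
    obtain rfl : a = y := by grind
    rcases key _ _ _ hxy hxz hyz hz ha with h | h
    · exact Or.inl ⟨ha, h⟩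
    · exact Or.inr (Or.inl ⟨ha, h⟩)
  · have h := hinj ha hd h
    simp only [Sym2.eq_iff] at h
    obtain rfl : a = z := by grind
    rcases key _ _ _ hxz hxy hyz.symm hy ha with h | h
    · exact Or.inl ⟨h, ha⟩
    · rw [Sym2.eq_swap] at h
      exact Or.inr (Or.inr ⟨ha, h⟩)
  · have h := hinj hb hd h
    simp only [Sym2.eq_iff] at h
    obtain rfl : b = z := by grind
    rcases key _ _ _ hyz hxy.symm hxz.symm hy.symm hb with h | h
    · rw [Sym2.eq_swap] at h
      exact Or.inr (Or.inl ⟨h, hb⟩)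
    · rw [Sym2.eq_swap] at h
      exact Or.inr (Or.inr ⟨h, hb⟩)

lemma not_rainbowConnectsTriples_one (G : SimpleGraph (Fin 4)) :
    ¬ G.RainbowConnectsTriples 1 := by
  rintro ⟨c, hc⟩
  obtain ⟨F, -, hlt, hinj, hy, hz⟩ := hc 0 1 2
  have hsub : ∀ e ∈ F, ∀ e' ∈ F, e = e' := fun e he e' he' =>
    hinj he he' (by have := hlt e he; have := hlt e' he'; omega)
  rcases mem_of_two_colors (fun e he => (hlt e he).trans one_lt_two) hinj (by decide) (by decide)
    (by decide) hy hz with h | h | h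
  all_goals
    have := hsub _ h.1 _ h.2
    revert this
    decide

/-- The two non-adjacent vertices `0`, `1` see each other vertex in different colors. Two of the
remaining three vertices are seen by `0` in the same color, hence by `1` in the other color, and no
color is left for the edge between them. -/
lemma not_rainbowConnectsTriples_completeFiveMinusEdge :
    ¬ completeFiveMinusEdge.RainbowConnectsTriples 2 := by
  rintro ⟨c, hc⟩
  have key : ∀ x y z : Fin 5, x ≠ y → x ≠ z → y ≠ z →
      ∃ F ⊆ completeFiveMinusEdge.edgeSet, (∀ e ∈ F, c e < 2) ∧ Set.InjOn c F ∧
      ((s(x, y) ∈ F ∧ s(x, z) ∈ F) ∨ (s(x, y) ∈ F ∧ s(y, z) ∈ F) ∨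
        (s(x, z) ∈ F ∧ s(y, z) ∈ F)) := by
    intro x y z hxy hxz hyz
    obtain ⟨F, hF, hlt, hinj, hy, hz⟩ := hc x y z
    exact ⟨F, hF, hlt, hinj, mem_of_two_colors hlt hinj hxy hxz hyz hy hz⟩
  have hsee : ∀ x : Fin 5, x ≠ 0 → x ≠ 1 →
      c s(0, x) < 2 ∧ c s(1, x) < 2 ∧ c s(0, x) ≠ c s(1, x) := by
    intro x h0 h1
    obtain ⟨F, hF, hlt, hinj, h⟩ := key 0 1 x (by decide) h0.symm h1.symm
    have h01 : s(0, 1) ∉ F := fun h => by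
      have := hF h
      rw [mem_edgeSet, completeFiveMinusEdge, deleteEdges_adj] at this
      exact this.2 rfl
    have h : s(0, x) ∈ F ∧ s(1, x) ∈ F := by tauto
    refine ⟨hlt _ h.1, hlt _ h.2, fun heq => ?_⟩
    have := hinj h.1 h.2 heq
    rw [Sym2.eq_iff] at this
    rcases this with h | h
    · exact absurd h.1 (by decide)
    · exact h0 h.1.symm
  have hmid : ∀ a x y : Fin 5, a ≠ x → a ≠ y → x ≠ y → c s(a, x) = c s(a, y) →
      c s(x, y) < 2 ∧ c s(x, y) ≠ c s(a, x) := by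
    intro a x y hax hay hxy heq
    obtain ⟨F, -, hlt, hinj, h⟩ := key a x y hax hay hxy
    rcases h with h | h | h
    · have := hinj h.1 h.2 heq
      rw [Sym2.eq_iff] at this
      grind
    · refine ⟨hlt _ h.2, fun heq' => ?_⟩
      have := hinj h.2 h.1 heq'
      rw [Sym2.eq_iff] at this
      grind
    · refine ⟨hlt _ h.2, fun heq' => ?_⟩
      have := hinj h.2 h.1 (heq'.trans heq)
      rw [Sym2.eq_iff] at this
      grind
  have main : ∀ x y : Fin 5, x ≠ 0 → x ≠ 1 → y ≠ 0 → y ≠ 1 → x ≠ y → c s(0, x) ≠ c s(0, y) := by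
    intro x y hx0 hx1 hy0 hy1 hxy heq
    have h1 := hsee x hx0 hx1
    have h2 := hsee y hy0 hy1
    have h3 := hmid 0 x y hx0.symm hy0.symm hxy heq
    have h4 := hmid 1 x y hx1.symm hy1.symm hxy (by omega)
    omega
  have h23 := main 2 3 (by decide) (by decide) (by decide) (by decide) (by decide)
  have h24 := main 2 4 (by decide) (by decide) (by decide) (by decide) (by decide)
  have h34 := main 3 4 (by decide) (by decide) (by decide) (by decide) (by decide)
  have h2 := hsee 2 (by decide) (by decide)
  have h3 := hsee 3 (by decide) (by decide)
  have h4 := hsee 4 (by decide) (by decide)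
  omega

/-- The vertices `0`, `2`, `4` of the 3-sun are pairwise non-adjacent and have no common neighbor,
so three edges cannot connect them. -/
lemma not_rainbowConnectsTriples_threeSun : ¬ threeSun.RainbowConnectsTriples 3 := by
  rintro ⟨c, hc⟩
  obtain ⟨F, hF, hlt, hinj, h2, h4⟩ := hc 0 2 4
  obtain ⟨a, ha, -⟩ := h2.exists_mem_of_ne (by decide)
  obtain ⟨b, hb, -⟩ := h2.symm.exists_mem_of_ne (by decide)
  obtain ⟨d, hd, -⟩ := h4.symm.exists_mem_of_ne (by decide)
  have haF : a = 1 ∨ a = 5 := by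
    have h := hF ha
    rw [mem_edgeSet, threeSun_adj_iff, cycleGraph_adj_iff_val (by norm_num)] at h
    clear * - h
    revert a
    decide
  have hbF : b = 1 ∨ b = 3 := by
    have h := hF hb
    rw [mem_edgeSet, threeSun_adj_iff, cycleGraph_adj_iff_val (by norm_num)] at h
    clear * - h
    revert b
    decide
  have hdF : d = 3 ∨ d = 5 := by
    have h := hF hd
    rw [mem_edgeSet, threeSun_adj_iff, cycleGraph_adj_iff_val (by norm_num)] at h
    clear * - h
    revert d
    decide
  have hab : c s(0, a) ≠ c s(2, b) := fun h => by
    have := hinj ha hb h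
    rw [Sym2.eq_iff] at this
    omega
  have had : c s(0, a) ≠ c s(4, d) := fun h => by
    have := hinj ha hd h
    rw [Sym2.eq_iff] at this
    omega
  have hbd : c s(2, b) ≠ c s(4, d) := fun h => by
    have := hinj hb hd h
    rw [Sym2.eq_iff] at this
    omega
  have hall : ∀ e ∈ F, e = s(0, a) ∨ e = s(2, b) ∨ e = s(4, d) := by
    intro e he
    have h1 := hlt _ ha
    have h2 := hlt _ hb
    have h3 := hlt _ hd
    have h4 := hlt _ he
    rcases (by omega : c e = c s(0, a) ∨ c e = c s(2, b) ∨ c e = c s(4, d)) with h | h | h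
    · exact Or.inl (hinj he ha h)
    · exact Or.inr (Or.inl (hinj he hb h))
    · exact Or.inr (Or.inr (hinj he hd h))
  -- the three edges form a star forest; the component of `0` is the star around `a`
  have hcl : ∀ p q, (fromEdgeSet F).Adj p q →
      p ∈ {v | v = 0 ∨ v = a ∨ (v = 2 ∧ b = a) ∨ (v = 4 ∧ d = a)} →
      q ∈ {v | v = 0 ∨ v = a ∨ (v = 2 ∧ b = a) ∨ (v = 4 ∧ d = a)} := by
    intro p q hpq hp
    simp only [Set.mem_ofPred_eq] at hp ⊢
    rcases hall _ ((fromEdgeSet_adj _).1 hpq).1 with h | h | h <;> rw [Sym2.eq_iff] at h <;> omega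
  have m2 := h2.mem_of_closed hcl (Or.inl rfl)
  have m4 := h4.mem_of_closed hcl (Or.inl rfl)
  simp only [Set.mem_ofPred_eq] at m2 m4
  omega

/-- A coloring of the positions `0, …, n - 1` on a circle by `n - 3` colors admits a cut of the
circle into three arcs such that the complement of each arc repeats a color. Positions repeating an
earlier color number at least three. Two of them in the same color yield a color used three times,
and the cut separates its positions; otherwise they yield three disjoint monochromatic pairs, and
the cut puts two of these six positions into each arc. -/
lemma exists_arcs_complement_repeats {n : ℕ} (hn : 4 ≤ n) (γ : ℕ → ℕ) (hγ : ∀ i, γ i < n - 3) :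
    ∃ p q r, p < q ∧ q < r ∧ r < n ∧
      (∃ i j, i < j ∧ j < n ∧ γ i = γ j ∧ ¬ (p ≤ i ∧ i < q) ∧ ¬ (p ≤ j ∧ j < q)) ∧
      (∃ i j, i < j ∧ j < n ∧ γ i = γ j ∧ ¬ (q ≤ i ∧ i < r) ∧ ¬ (q ≤ j ∧ j < r)) ∧
      (∃ i j, i < j ∧ j < n ∧ γ i = γ j ∧ (p ≤ i ∧ i < r) ∧ (p ≤ j ∧ j < r)) := by
  classical
  let M := (Finset.range n).filter fun m => ∃ j < m, γ j = γ m
  have hM : 3 ≤ M.card := by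
    have h1 : ((Finset.range n).filter fun m => ¬ ∃ j < m, γ j = γ m).card ≤ n - 3 := by
      rw [← Finset.card_range (n - 3)]
      refine Finset.card_le_card_of_injOn γ (fun i _ => by simpa using hγ i) ?_
      intro i hi j hj hij
      simp only [Finset.coe_filter, Set.mem_ofPred_eq, not_exists, not_and] at hi hj
      rcases lt_trichotomy i j with h | h | h
      · exact absurd hij (hj.2 i h)
      · exact h
      · exact absurd hij.symm (hi.2 j h)
    have h2 := Finset.card_filter_add_card_filter_not (s := Finset.range n)
      (fun m => ∃ j < m, γ j = γ m)
    rw [Finset.card_range] at h2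
    change M.card + _ = n at h2
    omega
  obtain ⟨T, hTM, hT⟩ := Finset.exists_subset_card_eq hM
  obtain ⟨m₁, m₂, m₃, h12, h13, h23, rfl⟩ := Finset.card_eq_three.1 hT
  have hmem : ∀ m ∈ ({m₁, m₂, m₃} : Finset ℕ), m < n ∧ ∃ j < m, γ j = γ m := fun m hm => by
    have := hTM hm
    simpa [M] using this
  -- a color used twice by repetitions
  have htriple : ∀ m ∈ ({m₁, m₂, m₃} : Finset ℕ), ∀ m' ∈ ({m₁, m₂, m₃} : Finset ℕ), m < m' →
      γ m = γ m' → ∃ i j k, i < j ∧ j < k ∧ k < n ∧ γ i = γ j ∧ γ j = γ k := by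
    intro m hm m' hm' hlt heq
    obtain ⟨-, j, hj, hjm⟩ := hmem m hm
    exact ⟨j, m, m', hj, hlt, (hmem m' hm').1, hjm, heq⟩
  by_cases htri : ∃ i j k, i < j ∧ j < k ∧ k < n ∧ γ i = γ j ∧ γ j = γ k
  · obtain ⟨i, j, k, hij, hjk, hk, h1, h2⟩ := htri
    exact ⟨i, j, k, hij, hjk, hk, ⟨j, k, hjk, hk, h2, by omega, by omega⟩,
      ⟨i, k, by omega, hk, h1.trans h2, by omega, by omega⟩,
      ⟨i, j, hij, by omega, h1, by omega, by omega⟩⟩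
  have hne : ∀ m ∈ ({m₁, m₂, m₃} : Finset ℕ), ∀ m' ∈ ({m₁, m₂, m₃} : Finset ℕ), m ≠ m' →
      γ m ≠ γ m' := by
    intro m hm m' hm' hne heq
    rcases lt_or_gt_of_ne hne with h | h
    · exact htri (htriple m hm m' hm' h heq)
    · exact htri (htriple m' hm' m hm h heq.symm)
  have g12 := hne m₁ (by simp) m₂ (by simp) h12
  have g13 := hne m₁ (by simp) m₃ (by simp) h13
  have g23 := hne m₂ (by simp) m₃ (by simp) h23
  obtain ⟨n1, j₁, l1, e1⟩ := hmem m₁ (by simp)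
  obtain ⟨n2, j₂, l2, e2⟩ := hmem m₂ (by simp)
  obtain ⟨n3, j₃, l3, e3⟩ := hmem m₃ (by simp)
  clear hne htriple htri hmem hTM hT hM
  let E : Finset ℕ := {j₁, m₁, j₂, m₂, j₃, m₃}
  have hE : E.card = 6 := by
    have hd : ∀ x y, γ x ≠ γ y → x ≠ y := fun x y h e => h (congrArg γ e)
    have d1 := hd j₁ j₂ (by omega)
    have d2 := hd j₁ m₂ (by omega)
    have d3 := hd j₁ j₃ (by omega)
    have d4 := hd j₁ m₃ (by omega)
    have d5 := hd m₁ j₂ (by omega)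
    have d6 := hd m₁ j₃ (by omega)
    have d7 := hd j₂ j₃ (by omega)
    have d8 := hd j₂ m₃ (by omega)
    have d9 := hd m₂ j₃ (by omega)
    have : [j₁, m₁, j₂, m₂, j₃, m₃].Nodup := by
      simp [*, l1.ne, l2.ne, l3.ne]
    simpa [E] using List.toFinset_card_of_nodup this
  -- a set of positions containing only two of the six misses one of the three pairs
  have hmiss : ∀ (X : ℕ → Prop) (s t : ℕ), (∀ e ∈ E, X e → e = s ∨ e = t) →
      ∃ i j, i < j ∧ j < n ∧ γ i = γ j ∧ ¬ X i ∧ ¬ X j := by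
    intro X s t hX
    by_contra! hcon
    have hst : ∀ j m, j ∈ E → m ∈ E → j < m → m < n → γ j = γ m → γ m = γ s ∨ γ m = γ t := by
      intro j m hj hm hjm hmn hγjm
      by_cases hXj : X j
      · rcases hX j hj hXj with rfl | rfl
        · exact Or.inl hγjm.symm
        · exact Or.inr hγjm.symm
      · rcases hX m hm (hcon j m hjm hmn hγjm hXj) with rfl | rfl
        · exact Or.inl rfl
        · exact Or.inr rfl
    have y1 := hst j₁ m₁ (by simp [E]) (by simp [E]) l1 n1 e1
    have y2 := hst j₂ m₂ (by simp [E]) (by simp [E]) l2 n2 e2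
    have y3 := hst j₃ m₃ (by simp [E]) (by simp [E]) l3 n3 e3
    omega
  let o := E.orderEmbOfFin hE
  have ho : ∀ e ∈ E, ∃ k, o k = e := by
    intro e he
    have : e ∈ Set.range o := by rw [Finset.range_orderEmbOfFin]; exact he
    exact this
  have hlt : ∀ a b, o a < o b ↔ a < b := fun a b => o.lt_iff_lt
  have hle : ∀ a b, o a ≤ o b ↔ a ≤ b := fun a b => o.le_iff_le
  have ho4 : o 4 < n := by
    have : o 4 ∈ E := Finset.orderEmbOfFin_mem E hE 4
    simp only [E, Finset.mem_insert, Finset.mem_singleton] at this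
    omega
  refine ⟨o 0, o 2, o 4, (hlt _ _).2 (by decide), (hlt _ _).2 (by decide), ho4,
    hmiss (fun i => o 0 ≤ i ∧ i < o 2) (o 0) (o 1) ?_,
    hmiss (fun i => o 2 ≤ i ∧ i < o 4) (o 2) (o 3) ?_, ?_⟩
  · intro e he hX
    obtain ⟨k, rfl⟩ := ho e he
    rw [hle, hlt] at hX
    rcases (by omega : k = 0 ∨ k = 1) with rfl | rfl <;> simp
  · intro e he hX
    obtain ⟨k, rfl⟩ := ho e he
    rw [hle, hlt] at hX
    rcases (by omega : k = 2 ∨ k = 3) with rfl | rfl <;> simp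
  · obtain ⟨i, j, hij, hj, hg, hi', hj'⟩ := hmiss (fun i => ¬ (o 0 ≤ i ∧ i < o 4)) (o 4) (o 5) (by
      intro e he hX
      obtain ⟨k, rfl⟩ := ho e he
      rw [hle, hlt] at hX
      rcases (by omega : k = 4 ∨ k = 5) with rfl | rfl <;> simp)
    exact ⟨i, j, hij, hj, hg, not_not.1 hi', not_not.1 hj'⟩

/-- A connected set of edges of a cycle that contains three given vertices contains two of the three
arcs between them; the vertices are chosen such that any two of the arcs repeat a color. -/
theorem not_rainbowConnectsTriples_cycleGraph {n : ℕ} (hn : 4 ≤ n) :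
    ¬ (cycleGraph n).RainbowConnectsTriples (n - 3) := by
  rintro ⟨c, hc⟩
  have : NeZero n := ⟨by omega⟩
  -- the `i`-th edge of the cycle
  let E : ℕ → Sym2 (Fin n) := fun i => s(Fin.ofNat n i, Fin.ofNat n (i + 1))
  have hE : ∀ i j, i < j → j < n → E i ≠ E j := by
    intro i j hij hj h
    simp only [E, Sym2.eq_iff, Fin.ext_iff, Fin.val_ofNat] at h
    rw [Nat.mod_eq_of_lt hj, Nat.mod_eq_of_lt (by omega : i < n),
      Nat.mod_eq_of_lt (by omega : i + 1 < n)] at h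
    rcases eq_or_ne (j + 1) n with h' | h'
    · rw [h', Nat.mod_self] at h; omega
    · rw [Nat.mod_eq_of_lt (by omega : j + 1 < n)] at h; omega
  have hEstep : ∀ a b : Fin n, a.val + 1 = b.val → s(a, b) = E a := by
    intro a b hab
    have hb := b.isLt
    simp only [E, Sym2.eq_iff, Fin.ext_iff, Fin.val_ofNat]
    rw [Nat.mod_eq_of_lt (by omega : a.val < n), Nat.mod_eq_of_lt (by omega : a.val + 1 < n)]
    exact Or.inl ⟨rfl, hab.symm⟩
  have hEclose : ∀ a b : Fin n, a.val = 0 → b.val + 1 = n → s(a, b) = E b := by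
    intro a b ha hb
    simp only [E, Sym2.eq_iff, Fin.ext_iff, Fin.val_ofNat]
    rw [hb, Nat.mod_self, Nat.mod_eq_of_lt (by omega : b.val < n)]
    exact Or.inr ⟨ha, rfl⟩
  obtain ⟨p, q, r, hpq, hqr, hr, hA, hB, hC⟩ :=
    exists_arcs_complement_repeats hn (fun i => c (E i) % (n - 3))
      (fun i => Nat.mod_lt _ (by omega))
  obtain ⟨F, hF, hlt, hinj, hpq', hpr'⟩ := hc ⟨p, by omega⟩ ⟨q, by omega⟩ ⟨r, hr⟩
  -- of two edges with equal colors one is omitted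
  have homit : ∀ i j, i < j → j < n → c (E i) % (n - 3) = c (E j) % (n - 3) →
      E i ∉ F ∨ E j ∉ F := by
    intro i j hij hj h
    by_contra! hcon
    rw [Nat.mod_eq_of_lt (hlt _ hcon.1), Nat.mod_eq_of_lt (hlt _ hcon.2)] at h
    exact hE i j hij hj (hinj hcon.1 hcon.2 h)
  -- two omitted edges separate the vertices between them from the others
  have hclosed : ∀ i j, i < j → j < n → E i ∉ F → E j ∉ F →
      ∀ x y : Fin n, (fromEdgeSet F).Reachable x y → (i < x.val ∧ x.val ≤ j) →
        (i < y.val ∧ y.val ≤ j) := by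
    intro i j hij hj hi' hj' x y hxy hx
    refine hxy.mem_of_closed (A := {v | i < v.val ∧ v.val ≤ j}) ?_ hx
    intro a b hab ha
    simp only [Set.mem_ofPred_eq] at ha ⊢
    have habF := ((fromEdgeSet_adj _).1 hab).1
    have hadj : (cycleGraph n).Adj a b := hF habF
    rcases (cycleGraph_adj_iff_val (by omega)).1 hadj with h | h | h | h
    · rw [hEstep a b h] at habF
      have : a.val ≠ j := by rintro rfl; exact hj' habF
      omega
    · rw [Sym2.eq_swap, hEstep b a h] at habF
      have : b.val ≠ i := by rintro rfl; exact hi' habF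
      omega
    · omega
    · rw [Sym2.eq_swap, hEclose b a h.1 h.2] at habF
      have : a.val ≠ j := by rintro rfl; exact hj' habF
      omega
  have hsep : ∀ i j, i < j → j < n → E i ∉ F → E j ∉ F →
      ((i < p ∧ p ≤ j) ↔ (i < q ∧ q ≤ j)) ∧ ((i < p ∧ p ≤ j) ↔ (i < r ∧ r ≤ j)) := by
    intro i j hij hj hi' hj'
    have h := hclosed i j hij hj hi' hj'
    exact ⟨⟨h _ _ hpq', h _ _ hpq'.symm⟩, ⟨h _ _ hpr', h _ _ hpr'.symm⟩⟩
  -- each arc is avoided by an omitted edge, so two omitted edges lie in different arcs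
  have hout : ∀ X : ℕ → Prop, (∃ i j, i < j ∧ j < n ∧
      c (E i) % (n - 3) = c (E j) % (n - 3) ∧ X i ∧ X j) → ∃ i < n, E i ∉ F ∧ X i := by
    rintro X ⟨i, j, hij, hj, h, hi', hj'⟩
    rcases homit i j hij hj h with h | h
    · exact ⟨i, by omega, h, hi'⟩
    · exact ⟨j, hj, h, hj'⟩
  obtain ⟨x, hxn, hx, hxA⟩ := hout (fun i => ¬ (p ≤ i ∧ i < q)) hA
  obtain ⟨y, hyn, hy, hyB⟩ := hout (fun i => ¬ (q ≤ i ∧ i < r)) hB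
  obtain ⟨z, hzn, hz, hzC⟩ := hout (fun i => p ≤ i ∧ i < r) hC
  have h1 := fun h => hsep x y h hyn hx hy
  have h2 := fun h => hsep y x h hxn hy hx
  have h3 := fun h => hsep x z h hzn hx hz
  have h4 := fun h => hsep z x h hxn hz hx
  have h5 := fun h => hsep y z h hzn hy hz
  have h6 := fun h => hsep z y h hyn hz hy
  clear * - hpq hqr hr h1 h2 h3 h4 h5 h6 hxA hyB hzC hxn hyn hzn
  omega

end SimpleGraph

open SimpleGraph in
theorem mainTheorem6 {V : Type*} [Fintype V] (G : SimpleGraph V) (n : ℕ)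
    (hcard : Fintype.card V = n) (hn : 4 ≤ n) (hG : G.IsTwoConnected) :
    G.rainbowIndex 3 ≤ ((n - 2 : ℕ) : ℕ∞) ∧
      (G.rainbowIndex 3 = ((n - 2 : ℕ) : ℕ∞) ↔
        Nonempty (G ≃g SimpleGraph.cycleGraph n) ∨
        G.IsSpanningSubgraphOf SimpleGraph.threeSun ∨
        G.IsSpanningSubgraphOf SimpleGraph.completeFiveMinusEdge ∨
        G.IsSpanningSubgraphOf (⊤ : SimpleGraph (Fin 4))) := by
  have hV : 3 ≤ Fintype.card V := by omega
  have hle : G.rainbowIndex 3 ≤ ((n - 2 : ℕ) : ℕ∞) :=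
    (rainbowIndex_three_le_iff G hV (by omega)).2 (hG.rainbowConnectsTriples hn hcard)
  -- equality holds exactly if `n - 3` colors do not suffice
  have heq : G.rainbowIndex 3 = ((n - 2 : ℕ) : ℕ∞) ↔ ¬ G.RainbowConnectsTriples (n - 3) := by
    rw [← rainbowIndex_three_le_iff G hV (by omega), not_le,
      ← ENat.add_one_le_iff (ENat.natCast_ne_top _), ← Nat.cast_one, ← Nat.cast_add,
      show n - 3 + 1 = n - 2 by omega]
    exact ⟨fun h => h.ge, fun h => le_antisymm hle h⟩
  refine ⟨hle, heq.trans ⟨fun hnot => ?_, ?_⟩⟩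
  · obtain rfl | rfl | rfl | h7 : n = 4 ∨ n = 5 ∨ n = 6 ∨ 7 ≤ n := by omega
    · exact Or.inr (Or.inr (Or.inr
        ⟨Fintype.equivFinOfCardEq hcard, fun u v huv => (Equiv.injective _).ne huv.ne⟩))
    · rcases isSpanningSubgraphOf_completeFiveMinusEdge_or_eq_top hcard G with h | rfl
      · exact Or.inr (Or.inr (Or.inl h))
      · exact absurd (rainbowConnectsTriples_top hcard) hnot
    · have hham := (hG.cycleGraph_or_rainbowConnectsTriples le_rfl hcard).resolve_right hnot
      exact Or.inr (Or.inl
        ((isSpanningSubgraphOf_threeSun_or_rainbowConnectsTriples hham).resolve_right hnot))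
    · have hham := (hG.cycleGraph_or_rainbowConnectsTriples (by omega) hcard).resolve_right hnot
      exact Or.inl ((cycleGraph_iso_or_rainbowConnectsTriples h7 hham).resolve_right hnot)
  · rintro (h | h | h | h) hrb
    · obtain ⟨e⟩ := h
      exact not_rainbowConnectsTriples_cycleGraph hn
        (hrb.of_isSpanningSubgraphOf ⟨e.toEquiv, fun _ _ h => e.map_rel_iff.2 h⟩)
    · obtain rfl : n = 6 := by
        obtain ⟨f, -⟩ := h
        rw [← hcard, Fintype.card_congr f, Fintype.card_fin]
      exact not_rainbowConnectsTriples_threeSun (hrb.of_isSpanningSubgraphOf h)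
    · obtain rfl : n = 5 := by
        obtain ⟨f, -⟩ := h
        rw [← hcard, Fintype.card_congr f, Fintype.card_fin]
      exact not_rainbowConnectsTriples_completeFiveMinusEdge (hrb.of_isSpanningSubgraphOf h)
    · obtain rfl : n = 4 := by
        obtain ⟨f, -⟩ := h
        rw [← hcard, Fintype.card_congr f, Fintype.card_fin]
      exact not_rainbowConnectsTriples_one _ (hrb.of_isSpanningSubgraphOf h)
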